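/- Let $d\ge 1$ be an integer. For $t>0$ and $x,y\in\mathbb R^d$ let $g(t,x,y)=(4\pi t)^{-d/2}e^{-|y-x|^2/(4t)}$. For a Borel measurable function $V:\mathbb R^d\to\mathbb R$ put $$S(V,t,x,y)=\int_0^t\int_{\mathbb R^d}\frac{g(s,x,z)\,g(t-s,z,y)}{g(t,x,y)}\,|V(z)|\,dz\,ds,\qquad \|S(V)\|_{T,\infty}=\sup_{0<t\le T}\ \sup_{x,y\in\mathbb R^d}S(V,t,x,y).$$ For $t>0$ and $x,y\in\mathbb R^d$ define the kernel $$K(t,x,y)=\begin{cases} e^{-\frac{|x||y|-\langle x,y\rangle}{2}}\,\dfrac{1}{|x|^{d-2}}\,(1+|x||y|)^{d/2-3/2}\,\mathbf 1_{|x|\le t|y|}, & d\ge 3,\\[2mm] e^{-\frac{|x||y|-\langle x,y\rangle}{2}}\,\log\Bigl(1+\dfrac{1}{\sqrt{|x||y|}}\Bigr)\,\mathbf 1_{|x|\le t|y|}, & d=2,\\[2mm] e^{-\frac{|x||y|-\langle x,y\rangle}{2}}\,\sqrt t\,(1+t|y|^2)^{-1/2}\,\mathbf 1_{|x|\le t|y|},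 & d=1 \end{cases}$$ (the value at the single point $x=0$ being immaterial), and $$\|K(V,t)\|_\infty=\sup_{x,y\in\mathbb R^d}\int_{\mathbb R^d}K(t,z-x,y)\,|V(z)|\,dz .$$ All these quantities take values in $[0,\infty]$. Theorem. There are constants $0<C_1<C_2<\infty$ depending only on $d$ such that for all $T>0$ and all Borel measurable $V:\mathbb R^d\to\mathbb R$, $$C_1\,\|K(V,T)\|_\infty\le\|S(V)\|_{T,\infty}\le C_2\,\|K(V,T)\|_\infty .$$ -/

import Mathlib

open MeasureTheory
open scoped ENNReal

namespace SharpGauss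

/-- The Gauss-Weierstrass kernel `g(t,x,y) = (4πt)^(-d/2) exp(-|y-x|²/(4t))` (used for `t > 0`). -/
noncomputable def g {d : ℕ} (t : ℝ) (x y : EuclideanSpace ℝ (Fin d)) : ℝ :=
  (4 * Real.pi * t) ^ (-(d : ℝ) / 2) * Real.exp (-‖y - x‖ ^ 2 / (4 * t))

/-- `S(V,t,x,y) = ∫_0^t ∫ g(s,x,z) g(t-s,z,y) / g(t,x,y) |V(z)| dz ds`, with values in `[0,∞]`. -/
noncomputable def S {d : ℕ} (V : EuclideanSpace ℝ (Fin d) → ℝ) (t : ℝ)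
    (x y : EuclideanSpace ℝ (Fin d)) : ℝ≥0∞ :=
  ∫⁻ s in Set.Ioo 0 t, ∫⁻ z, ENNReal.ofReal (g s x z * g (t - s) z y / g t x y * |V z|)

/-- `‖S(V,t)‖_∞`, the supremum of `S(V,t,x,y)` over all `x` and `y`. -/
noncomputable def normS {d : ℕ} (V : EuclideanSpace ℝ (Fin d) → ℝ) (t : ℝ) : ℝ≥0∞ :=
  ⨆ (x : EuclideanSpace ℝ (Fin d)) (y : EuclideanSpace ℝ (Fin d)), S V t x y

/-- `‖S(V)‖_{T,∞}`, the supremum of `‖S(V,t)‖_∞` over `0 < t ≤ T`. -/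
noncomputable def normSUpTo {d : ℕ} (V : EuclideanSpace ℝ (Fin d) → ℝ) (T : ℝ) : ℝ≥0∞ :=
  ⨆ t ∈ Set.Ioc 0 T, normS V t

/-- The kernel `K(t,x,y)`; the last branch is the one for `d = 1`. In dimension `d ≥ 2` the kernel
is singular at `x = 0`, where `1 / 0 = 0` below: a single point `x`, which does not matter for
integrals in `x`. If `y = 0`, the kernel vanishes for all `x ≠ 0`. -/
noncomputable def K {d : ℕ} (t : ℝ) (x y : EuclideanSpace ℝ (Fin d)) : ℝ :=
  if ‖x‖ ≤ t * ‖y‖ then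
    Real.exp (-(‖x‖ * ‖y‖ - inner ℝ x y) / 2) *
      (if 3 ≤ d then
        1 / ‖x‖ ^ ((d : ℝ) - 2) * (1 + ‖x‖ * ‖y‖) ^ ((d : ℝ) / 2 - 3 / 2)
      else if d = 2 then
        Real.log (1 + 1 / Real.sqrt (‖x‖ * ‖y‖))
      else
        Real.sqrt t * (1 + t * ‖y‖ ^ 2) ^ (-(1 / 2) : ℝ))
  else 0

/-- `K(V,t,x,y) = ∫ K(t,z-x,y) |V(z)| dz`, with values in `[0,∞]`. -/
noncomputable def KV {d : ℕ} (V : EuclideanSpace ℝ (Fin d) → ℝ) (t : ℝ)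
    (x y : EuclideanSpace ℝ (Fin d)) : ℝ≥0∞ :=
  ∫⁻ z, ENNReal.ofReal (K t (z - x) y * |V z|)

/-- `‖K(V,t)‖_∞`, the supremum of `K(V,t,x,y)` over all `x` and `y`. -/
noncomputable def normK {d : ℕ} (V : EuclideanSpace ℝ (Fin d) → ℝ) (t : ℝ) : ℝ≥0∞ :=
  ⨆ (x : EuclideanSpace ℝ (Fin d)) (y : EuclideanSpace ℝ (Fin d)), KV V t x y

end SharpGauss

namespace SharpGauss

/-! The quotient `g s x z * g (t - s) z y / g t x y` is the density of a Brownian bridge: a Gaussian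
in `z` centred at `x + s • w`, with drift `w = (y - x)/t`, and with `s (t - s)/t` in place of the
time (`bridge_eq`). For `s < t/2` this effective time lies between `s/2` and `s`, so the bridge is
comparable to a heat kernel with drift `w`; reversing time and exchanging `x` and `y` treats the
other half. Thus `S` is governed by integrals of `|V|` against `driftKernel`, the time integral of
drifting heat kernels.

With `ζ = z - x`, the exponent splits (`norm_sub_smul_sq_div`) into an angular part independent of
`s`, which produces the exponential in `K`, and a radial part `(‖ζ‖ - s‖w‖)²/(c s)`. What remains is
a scalar Laplace integral. With `r = ‖ζ‖` and `a = ‖w‖`, it has a peak at `s = r/a` when `r a` is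
large, and for small `r a` it is the Green function at scale `r`, cut off at time `a⁻²` or `t`. Both
regimes match `krad` (`laplace_le_krad`, `krad_le_laplace`).

Some pieces do not match `K` pointwise: points with `‖ζ‖ > t‖w‖` in the upper bound, and times of
order `t` in the lower bound. They are Gaussians of width `√t`, or are dominated by `K` with a drift
of length `1/√t`. The Gaussians are controlled by the largest mass of `|V|` on balls of radius `√t`,
weighted by `t / √t ^ d`, and either norm dominates that quantity (`ballSup_le_normK`,
`ballSup_le_normSUpTo`). The two inequalities are assembled in `normSUpTo_le_normK` and
`normK_le_normSUpTo`. -/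

/-! ### Elementary integrals in the time variable. -/

lemma ofReal_mul_sub_le_setLIntegral {f : ℝ → ℝ} {x y c : ℝ} {A : Set ℝ} (hc : 0 ≤ c)
    (hA : Set.Ioo x y ⊆ A) (h : ∀ s ∈ Set.Ioo x y, c ≤ f s) :
    ENNReal.ofReal (c * (y - x)) ≤ ∫⁻ s in A, ENNReal.ofReal (f s) := by
  refine le_trans ?_ (lintegral_mono_set hA)
  calc ENNReal.ofReal (c * (y - x)) = ∫⁻ _ in Set.Ioo x y, ENNReal.ofReal c := by
        rw [setLIntegral_const, Real.volume_Ioo, ENNReal.ofReal_mul hc]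
    _ ≤ _ := setLIntegral_mono' measurableSet_Ioo fun s hs => ENNReal.ofReal_le_ofReal (h s hs)

lemma setLIntegral_Ioc_le_ofReal_mul_sub {f : ℝ → ℝ} {x y c : ℝ} (hc : 0 ≤ c)
    (h : ∀ s ∈ Set.Ioc x y, f s ≤ c) :
    ∫⁻ s in Set.Ioc x y, ENNReal.ofReal (f s) ≤ ENNReal.ofReal (c * (y - x)) := by
  calc _ ≤ ∫⁻ _ in Set.Ioc x y, ENNReal.ofReal c :=
        setLIntegral_mono' measurableSet_Ioc fun s hs => ENNReal.ofReal_le_ofReal (h s hs)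
    _ = _ := by rw [setLIntegral_const, Real.volume_Ioc, ENNReal.ofReal_mul hc]

lemma setLIntegral_ofReal_mono_const_mul {f h : ℝ → ℝ} {A : Set ℝ} {c m : ℝ}
    (hA : MeasurableSet A) (hc : 0 ≤ c)
    (hfh : ∀ s ∈ A, f s ≤ c * h s)
    (hm : ∫⁻ s in A, ENNReal.ofReal (h s) ≤ ENNReal.ofReal m) :
    ∫⁻ s in A, ENNReal.ofReal (f s) ≤ ENNReal.ofReal (c * m) := by
  calc _ ≤ ∫⁻ s in A, ENNReal.ofReal c * ENNReal.ofReal (h s) :=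
        setLIntegral_mono' hA fun s hs => by
          rw [← ENNReal.ofReal_mul hc]; exact ENNReal.ofReal_le_ofReal (hfh s hs)
    _ = ENNReal.ofReal c * ∫⁻ s in A, ENNReal.ofReal (h s) :=
        lintegral_const_mul' _ _ ENNReal.ofReal_ne_top
    _ ≤ ENNReal.ofReal c * ENNReal.ofReal m := by gcongr
    _ = _ := (ENNReal.ofReal_mul hc).symm

lemma setLIntegral_le_add_of_subset {f : ℝ → ℝ} {A B C : Set ℝ} {b c : ℝ}
    (hA : A ⊆ B ∪ C) (hb : 0 ≤ b) (hc : 0 ≤ c)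
    (hB : ∫⁻ s in B, ENNReal.ofReal (f s) ≤ ENNReal.ofReal b)
    (hC : ∫⁻ s in C, ENNReal.ofReal (f s) ≤ ENNReal.ofReal c) :
    ∫⁻ s in A, ENNReal.ofReal (f s) ≤ ENNReal.ofReal (b + c) := by
  rw [ENNReal.ofReal_add hb hc]
  exact (lintegral_mono_set hA).trans ((lintegral_union_le _ _ _).trans (add_le_add hB hC))

lemma setLIntegral_inv {x y : ℝ} (hx : 0 < x) (hxy : x ≤ y) :
    ∫⁻ s in Set.Ioc x y, ENNReal.ofReal s⁻¹ = ENNReal.ofReal (Real.log (y / x)) := by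
  have h0 : (0 : ℝ) ∉ Set.uIcc x y := by
    rw [Set.uIcc_of_le hxy]; exact fun h => absurd h.1 (not_le.2 hx)
  rw [← integral_inv h0, intervalIntegral.integral_of_le hxy,
    ofReal_integral_eq_lintegral_ofReal]
  · have : IntervalIntegrable (fun s : ℝ => s⁻¹) volume x y := by
      rw [intervalIntegrable_inv_iff]; exact Or.inr h0
    exact (intervalIntegrable_iff_integrableOn_Ioc_of_le hxy).1 this
  · exact (ae_restrict_mem measurableSet_Ioc).mono fun s hs => inv_nonneg.2 (hx.trans hs.1).le

lemma setLIntegral_exp_neg_mul_le {x b : ℝ} (hx : 0 ≤ x) (hb : 0 < b) :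
    ∫⁻ s in Set.Ioi x, ENNReal.ofReal (Real.exp (-b * s)) ≤ ENNReal.ofReal (1 / b) := by
  have hb' : -b < 0 := by linarith
  rw [← ofReal_integral_eq_lintegral_ofReal (integrableOn_exp_mul_Ioi hb' x)
    (Filter.Eventually.of_forall fun _ => (Real.exp_pos _).le), integral_exp_mul_Ioi hb']
  refine ENNReal.ofReal_le_ofReal ?_
  rw [neg_div_neg_eq]
  gcongr
  exact Real.exp_le_one_iff.2 (by nlinarith)

lemma lintegral_exp_neg_mul_sub_sq {b : ℝ} (hb : 0 < b) (c : ℝ) :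
    ∫⁻ s : ℝ, ENNReal.ofReal (Real.exp (-b * (s - c) ^ 2)) = ENNReal.ofReal (√(Real.pi / b)) := by
  rw [lintegral_sub_right_eq_self (fun s : ℝ => ENNReal.ofReal (Real.exp (-b * s ^ 2))) c,
    ← ofReal_integral_eq_lintegral_ofReal (integrable_exp_neg_mul_sq hb)
    (Filter.Eventually.of_forall fun _ => (Real.exp_pos _).le), integral_gaussian]

lemma setLIntegral_inv_sqrt_pow_le {x : ℝ} (hx : 0 < x) (k : ℕ) :
    ∫⁻ s in Set.Ioi x, ENNReal.ofReal (√s ^ (k + 3))⁻¹ ≤ ENNReal.ofReal (2 / √x ^ (k + 1)) := by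
  have key : ∀ s ∈ Set.Ioi x, (√s ^ (k + 3))⁻¹ = s ^ (-((k : ℝ) + 3) / 2) := by
    intro s hs
    have hs0 : 0 < s := hx.trans hs
    rw [Real.sqrt_eq_rpow, ← Real.rpow_natCast, ← Real.rpow_mul hs0.le, ← Real.rpow_neg hs0.le]
    congr 1; push_cast; ring
  have hk : -((k : ℝ) + 3) / 2 < -1 := by have := k.cast_nonneg (α := ℝ); linarith
  rw [setLIntegral_congr_fun measurableSet_Ioi fun s hs => by rw [key s hs],
    ← ofReal_integral_eq_lintegral_ofReal (integrableOn_Ioi_rpow_of_lt hk hx),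
    integral_Ioi_rpow_of_lt hk hx]
  · refine ENNReal.ofReal_le_ofReal ?_
    have : x ^ (-((k : ℝ) + 3) / 2 + 1) = (√x ^ (k + 1))⁻¹ := by
      rw [Real.sqrt_eq_rpow, ← Real.rpow_natCast, ← Real.rpow_mul hx.le, ← Real.rpow_neg hx.le]
      congr 1; push_cast; ring
    rw [this]
    have hp : 0 < √x ^ (k + 1) := by positivity
    have hk0 := k.cast_nonneg (α := ℝ)
    rw [show -(√x ^ (k + 1))⁻¹ / (-((k : ℝ) + 3) / 2 + 1) = (2 / (k + 1)) / √x ^ (k + 1) by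
      rw [show -((k : ℝ) + 3) / 2 + 1 = -((k + 1) / 2) by ring, neg_div_neg_eq]
      field_simp]
    gcongr
    rw [div_le_iff₀ (by positivity)]; linarith
  · exact (ae_restrict_mem measurableSet_Ioi).mono fun s hs => Real.rpow_nonneg (hx.trans hs).le _

lemma setLIntegral_inv_sqrt {x : ℝ} (hx : 0 ≤ x) :
    ∫⁻ s in Set.Ioc 0 x, ENNReal.ofReal (√s)⁻¹ = ENNReal.ofReal (2 * √x) := by
  have key : ∀ s ∈ Set.Ioc 0 x, (√s)⁻¹ = s ^ (-(1 / 2) : ℝ) := by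
    intro s hs
    rw [Real.sqrt_eq_rpow, ← Real.rpow_neg hs.1.le]
  have hI : IntervalIntegrable (fun s : ℝ => s ^ (-(1 / 2) : ℝ)) volume 0 x :=
    intervalIntegral.intervalIntegrable_rpow' (by norm_num)
  rw [setLIntegral_congr_fun measurableSet_Ioc fun s hs => by rw [key s hs],
    ← ofReal_integral_eq_lintegral_ofReal
      ((intervalIntegrable_iff_integrableOn_Ioc_of_le hx).1 hI),
    ← intervalIntegral.integral_of_le hx, integral_rpow (Or.inl (by norm_num))]
  · congr 1
    rw [Real.sqrt_eq_rpow, Real.zero_rpow (by norm_num)]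
    norm_num; ring
  · exact (ae_restrict_mem measurableSet_Ioc).mono fun s hs => Real.rpow_nonneg hs.1.le _

/-- `s^(-d/2) e^(-r²/(64 s))` is at most a constant times `r^(-d)`. -/
lemma inv_sqrt_pow_mul_exp_le (d : ℕ) {r s : ℝ} (hr : 0 < r) (hs : 0 < s) :
    (√s ^ d)⁻¹ * Real.exp (-(r ^ 2 / (64 * s))) ≤ 8 ^ d * d.factorial * Real.exp 1 / r ^ d := by
  have hq : 0 < √s := Real.sqrt_pos.2 hs
  -- In this scaling variable the claim is that `y ^ d * exp (-y²)` is bounded, which follows from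
  -- `y ^ d ≤ d! e^y` and `y - y² ≤ 1`.
  obtain ⟨y, hy⟩ : ∃ y, y = r / (8 * √s) := ⟨_, rfl⟩
  have hy0 : 0 < y := by rw [hy]; positivity
  have h1 : r ^ 2 / (64 * s) = y ^ 2 := by
    rw [hy, div_pow, mul_pow, Real.sq_sqrt hs.le]; norm_num
  have h2 : y ^ d ≤ d.factorial * Real.exp y := by
    have := Real.pow_div_factorial_le_exp y hy0.le d
    rwa [div_le_iff₀ (by positivity), mul_comm] at this
  have h3 : Real.exp y * Real.exp (-y ^ 2) ≤ Real.exp 1 := by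
    rw [← Real.exp_add]; exact Real.exp_le_exp.2 (by nlinarith [sq_nonneg (y - 1)])
  have h4 : (√s ^ d)⁻¹ = 8 ^ d * y ^ d / r ^ d := by
    rw [hy, div_pow, mul_pow]; field_simp
  rw [h1, h4, show (8 : ℝ) ^ d * y ^ d / r ^ d * Real.exp (-y ^ 2)
    = 8 ^ d * (y ^ d * Real.exp (-y ^ 2)) / r ^ d by ring, mul_assoc (8 ^ d : ℝ)]
  have h5 : y ^ d * Real.exp (-y ^ 2) ≤ d.factorial * Real.exp 1 :=
    calc y ^ d * Real.exp (-y ^ 2) ≤ d.factorial * Real.exp y * Real.exp (-y ^ 2) := by gcongr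
      _ ≤ _ := by rw [mul_assoc]; gcongr
  gcongr

/-! ### The radial factor of `K` and its form for large `r a`. -/

/-- The radial factor of the kernel `K`. -/
noncomputable def krad (d : ℕ) (t r a : ℝ) : ℝ :=
  if d = 1 then √t / √(1 + t * a ^ 2)
  else if d = 2 then Real.log (1 + 1 / √(r * a))
  else √(1 + r * a) ^ (d - 3) / r ^ (d - 2)

lemma krad_one (t r a : ℝ) : krad 1 t r a = √t / √(1 + t * a ^ 2) := by simp [krad]

lemma krad_two (t r a : ℝ) : krad 2 t r a = Real.log (1 + 1 / √(r * a)) := by simp [krad]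

lemma krad_add_three (k : ℕ) (t r a : ℝ) :
    krad (k + 3) t r a = √(1 + r * a) ^ k / r ^ (k + 1) := by
  simp [krad]

lemma eq_one_or_two_or_add_three {d : ℕ} (hd : 1 ≤ d) : d = 1 ∨ d = 2 ∨ ∃ k, d = k + 3 := by
  rcases Nat.lt_or_ge d 3 with h | h
  · omega
  · exact Or.inr (Or.inr ⟨d - 3, by omega⟩)

lemma krad_nonneg (d : ℕ) {t r a : ℝ} (hr : 0 ≤ r) : 0 ≤ krad d t r a := by
  unfold krad
  split_ifs
  · positivity
  · exact Real.log_nonneg (by linarith [show 0 ≤ 1 / √(r * a) by positivity])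
  · positivity

/-- The size of the Laplace integral `∫ s^(-d/2) e^(-(r-sa)²/s) ds` for large `ra`. -/
noncomputable def peak (d : ℕ) (r a : ℝ) : ℝ := r / a / (√(r / a) ^ d * √(r * a))

lemma log_one_add_inv_le {u : ℝ} (hu : 0 < u) : Real.log (1 + 1 / u) ≤ 1 / u := by
  have := Real.log_le_sub_one_of_pos (show 0 < 1 + 1 / u by positivity); linarith

lemma inv_two_mul_le_log_one_add_inv {u : ℝ} (hu : 1 ≤ u) : 1 / (2 * u) ≤ Real.log (1 + 1 / u) := by
  have := Real.one_sub_inv_le_log_of_pos (show 0 < 1 + 1 / u by positivity)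
  refine le_trans ?_ this
  have : 1 - (1 + 1 / u)⁻¹ = 1 / (u + 1) := by field_simp; ring
  rw [this]; gcongr; linarith

/-- Writing `r` and `a` as squares turns every square root into a monomial, so that comparisons with
`peak` become algebra. -/
lemma peak_sq {α β : ℝ} (hα : 0 < α) (hβ : 0 < β) (d : ℕ) :
    peak d (α ^ 2) (β ^ 2) = α / β ^ 3 * (β / α) ^ d := by
  have h1 : √(α ^ 2 / β ^ 2) = α / β := by
    rw [← div_pow, Real.sqrt_sq (by positivity)]
  have h2 : √(α ^ 2 * β ^ 2) = α * β := by
    rw [← mul_pow, Real.sqrt_sq (by positivity)]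
  rw [peak, h1, h2, div_pow, div_pow]; field_simp

/-- The threshold `1/16` only has to be a fixed positive number: it gives `1 ≤ 16 r a`, hence `√(1 +
r a) ≤ 5 √(r a)`, which is the source of `5 ^ d`. -/
lemma krad_le_peak {d : ℕ} (hd : 1 ≤ d) {t r a : ℝ} (ht : 0 < t) (hr : 0 < r) (ha : 0 < a)
    (hra : 1 / 16 ≤ r * a) : krad d t r a ≤ 5 ^ d * peak d r a := by
  obtain ⟨α, hα, rfl⟩ : ∃ α, 0 < α ∧ r = α ^ 2 := ⟨√r, Real.sqrt_pos.2 hr, (Real.sq_sqrt hr.le).symm⟩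
  obtain ⟨β, hβ, rfl⟩ : ∃ α, 0 < α ∧ a = α ^ 2 := ⟨√a, Real.sqrt_pos.2 ha, (Real.sq_sqrt ha.le).symm⟩
  rw [peak_sq hα hβ]
  have h2 : √(α ^ 2 * β ^ 2) = α * β := by
    rw [← mul_pow, Real.sqrt_sq (by positivity)]
  have h4 : 1 / 4 ≤ α * β := by
    rw [← mul_pow] at hra
    exact le_of_sq_le_sq (by linarith) (by positivity)
  rcases eq_one_or_two_or_add_three hd with rfl | rfl | ⟨k, rfl⟩
  · rw [krad_one]
    have h5 : √t * β ^ 2 ≤ √(1 + t * (β ^ 2) ^ 2) := by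
      apply Real.le_sqrt_of_sq_le
      rw [mul_pow, Real.sq_sqrt ht.le]; linarith
    calc √t / √(1 + t * (β ^ 2) ^ 2) ≤ √t / (√t * β ^ 2) := by gcongr
      _ = 1 / β ^ 2 := by field_simp
      _ ≤ 5 * (1 / β ^ 2) := by linarith [show 0 < 1 / β ^ 2 by positivity]
      _ = _ := by field_simp
  · rw [krad_two, h2]
    refine (log_one_add_inv_le (by positivity)).trans ?_
    calc 1 / (α * β) ≤ 25 * (1 / (α * β)) := by linarith [show 0 < 1 / (α * β) by positivity]
      _ = _ := by field_simp; norm_num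
  · rw [krad_add_three]
    have h5 : √(1 + α ^ 2 * β ^ 2) ≤ 5 * (α * β) := by
      apply Real.sqrt_le_iff.2 ⟨by positivity, by nlinarith⟩
    calc √(1 + α ^ 2 * β ^ 2) ^ k / (α ^ 2) ^ (k + 1)
        ≤ (5 * (α * β)) ^ k / (α ^ 2) ^ (k + 1) := by gcongr
      _ = 5 ^ k * (α / β ^ 3 * (β / α) ^ (k + 3)) := by
        simp only [mul_pow, div_pow]; field_simp; ring
      _ ≤ _ := by gcongr <;> norm_num

lemma peak_le_krad {d : ℕ} (hd : 1 ≤ d) {t r a : ℝ} (ht : 0 < t) (hr : 0 < r) (ha : 0 < a)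
    (hra : 1 ≤ r * a) (hrt : r ≤ t * a) : peak d r a ≤ 2 * krad d t r a := by
  have hta : 1 ≤ t * a ^ 2 := by nlinarith
  obtain ⟨α, hα, rfl⟩ : ∃ α, 0 < α ∧ r = α ^ 2 := ⟨√r, Real.sqrt_pos.2 hr, (Real.sq_sqrt hr.le).symm⟩
  obtain ⟨β, hβ, rfl⟩ : ∃ α, 0 < α ∧ a = α ^ 2 := ⟨√a, Real.sqrt_pos.2 ha, (Real.sq_sqrt ha.le).symm⟩
  rw [peak_sq hα hβ]
  have h2 : √(α ^ 2 * β ^ 2) = α * β := by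
    rw [← mul_pow, Real.sqrt_sq (by positivity)]
  have h4 : 1 ≤ α * β := by
    rw [← mul_pow] at hra
    exact le_of_sq_le_sq (by linarith) (by positivity)
  rcases eq_one_or_two_or_add_three hd with rfl | rfl | ⟨k, rfl⟩
  · rw [krad_one]
    have h5 : √(1 + t * (β ^ 2) ^ 2) ≤ 2 * (√t * β ^ 2) := by
      apply Real.sqrt_le_iff.2 ⟨by positivity, ?_⟩
      rw [mul_pow, mul_pow, Real.sq_sqrt ht.le]; nlinarith
    have h6 : 0 < √t := Real.sqrt_pos.2 ht
    calc α / β ^ 3 * (β / α) ^ 1 = 2 * (√t / (2 * (√t * β ^ 2))) := by field_simp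
      _ ≤ _ := by gcongr
  · rw [krad_two, h2]
    have := inv_two_mul_le_log_one_add_inv h4
    calc α / β ^ 3 * (β / α) ^ 2 = 2 * (1 / (2 * (α * β))) := by field_simp
      _ ≤ _ := by gcongr
  · rw [krad_add_three]
    have h5 : α * β ≤ √(1 + α ^ 2 * β ^ 2) := by
      apply Real.le_sqrt_of_sq_le; rw [mul_pow]; linarith
    calc α / β ^ 3 * (β / α) ^ (k + 3) = (α * β) ^ k / (α ^ 2) ^ (k + 1) := by
          simp only [mul_pow, div_pow]; field_simp; ring
      _ ≤ √(1 + α ^ 2 * β ^ 2) ^ k / (α ^ 2) ^ (k + 1) := by gcongr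
      _ ≤ _ := by linarith [show 0 ≤ √(1 + α ^ 2 * β ^ 2) ^ k / (α ^ 2) ^ (k + 1) by positivity]

/-! ### Upper bounds for the Laplace integral. -/

lemma ofReal_mul_log_le_setLIntegral {f : ℝ → ℝ} {x y c : ℝ} {A : Set ℝ} (hc : 0 ≤ c)
    (hx : 0 < x) (hxy : x ≤ y) (hA : Set.Ioo x y ⊆ A) (h : ∀ s ∈ Set.Ioo x y, c * s⁻¹ ≤ f s) :
    ENNReal.ofReal (c * Real.log (y / x)) ≤ ∫⁻ s in A, ENNReal.ofReal (f s) := by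
  refine le_trans ?_ (lintegral_mono_set hA)
  rw [ENNReal.ofReal_mul hc, ← setLIntegral_inv hx hxy, ← setLIntegral_congr Ioo_ae_eq_Ioc,
    ← lintegral_const_mul' _ _ ENNReal.ofReal_ne_top]
  refine setLIntegral_mono' measurableSet_Ioo fun s hs => ?_
  rw [← ENNReal.ofReal_mul hc]
  exact ENNReal.ofReal_le_ofReal (h s hs)

lemma sq_div_le_of_near {r a s : ℝ} (hs : 0 < s) (hr : 0 < r) (h : 2 * (s * a) ≤ r) :
    r ^ 2 / (64 * s) ≤ (r - s * a) ^ 2 / (16 * s) := by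
  rw [div_le_div_iff₀ (by positivity) (by positivity)]
  have : r ^ 2 ≤ 4 * (r - s * a) ^ 2 := by nlinarith
  nlinarith

lemma mul_sq_le_of_far {r a s : ℝ} (hs : 0 < s) (hr : 0 < r) (h : 2 * r ≤ s * a) :
    a ^ 2 / 64 * s ≤ (r - s * a) ^ 2 / (16 * s) := by
  rw [le_div_iff₀ (by positivity)]
  nlinarith

lemma weight_mul_exp_le (d : ℕ) {s m x : ℝ} (hm : 0 < m) (hs : m ≤ s) :
    (√s ^ d)⁻¹ * Real.exp x ≤ (√m ^ d)⁻¹ * Real.exp x := by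
  have := Real.sqrt_pos.2 hm
  gcongr

/-- Long before the peak time `r/a` one has `r - s a ≥ r/2`, so the exponential absorbs the singular
weight. -/
lemma laplace_near (d : ℕ) {r a m : ℝ} (hr : 0 < r) (ha : 0 ≤ a) (hma : 2 * (m * a) ≤ r) :
    ∫⁻ s in Set.Ioc 0 m, ENNReal.ofReal ((√s ^ d)⁻¹ * Real.exp (-((r - s * a) ^ 2 / (16 * s))))
      ≤ ENNReal.ofReal (8 ^ d * d.factorial * Real.exp 1 / r ^ d * m) := by
  have := setLIntegral_Ioc_le_ofReal_mul_sub (x := 0) (y := m)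
    (f := fun s => (√s ^ d)⁻¹ * Real.exp (-((r - s * a) ^ 2 / (16 * s))))
    (c := 8 ^ d * d.factorial * Real.exp 1 / r ^ d) (by positivity) ?_
  · simpa using this
  · intro s hs
    refine le_trans ?_ (inv_sqrt_pow_mul_exp_le d hr hs.1)
    have := sq_div_le_of_near (a := a) hs.1 hr (by nlinarith [hs.2])
    gcongr

/-- Well after the peak time `s a - r ≥ s a/2`, so the exponent is at least linear in `s` and the
tail is exponential. -/
lemma laplace_far (d : ℕ) {r a m : ℝ} (hr : 0 < r) (ha : 0 < a) (hm : 0 < m)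
    (hma : 2 * r ≤ m * a) :
    ∫⁻ s in Set.Ioi m, ENNReal.ofReal ((√s ^ d)⁻¹ * Real.exp (-((r - s * a) ^ 2 / (16 * s))))
      ≤ ENNReal.ofReal ((√m ^ d)⁻¹ * (64 / a ^ 2)) := by
  have h := setLIntegral_exp_neg_mul_le hm.le (show 0 < a ^ 2 / 64 by positivity)
  rw [one_div_div] at h
  refine setLIntegral_ofReal_mono_const_mul measurableSet_Ioi (by positivity) ?_ h
  intro s hs
  have hs' : m < s := hs
  refine (weight_mul_exp_le d hm hs'.le).trans ?_
  have := mul_sq_le_of_far (a := a) (hm.trans hs') hr (by nlinarith)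
  have := Real.exp_le_exp.2 (show -((r - s * a) ^ 2 / (16 * s)) ≤ -(a ^ 2 / 64) * s by linarith)
  gcongr

/-- Laplace's method: past `s = r/(2a)` the weight is at most its value there, and near `r/a` the
exponential is a Gaussian in `s` of width about `(r/a)/√(r a)`. The remaining contributions are of
lower order when `r a ≥ 1`. -/
lemma laplace_le_peak {d : ℕ} (hd : 1 ≤ d) : ∃ C : ℝ, 0 < C ∧ ∀ r a : ℝ, 0 < r → 0 < a →
    1 ≤ r * a →
    ∫⁻ s in Set.Ioi 0, ENNReal.ofReal ((√s ^ d)⁻¹ * Real.exp (-((r - s * a) ^ 2 / (16 * s))))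
      ≤ ENNReal.ofReal (C * peak d r a) := by
  refine ⟨8 ^ d * d.factorial * Real.exp 1 + 2 ^ d * 75, by positivity, ?_⟩
  intro r a hr ha hra
  obtain ⟨α, hα, rfl⟩ : ∃ α, 0 < α ∧ r = α ^ 2 := ⟨√r, Real.sqrt_pos.2 hr, (Real.sq_sqrt hr.le).symm⟩
  obtain ⟨β, hβ, rfl⟩ : ∃ α, 0 < α ∧ a = α ^ 2 := ⟨√a, Real.sqrt_pos.2 ha, (Real.sq_sqrt ha.le).symm⟩
  have h4 : 1 ≤ α * β := by
    rw [← mul_pow] at hra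
    exact le_of_sq_le_sq (by linarith) (by positivity)
  have hm : 0 < α ^ 2 / (2 * β ^ 2) := by positivity
  have hnear := laplace_near d (r := α ^ 2) (a := β ^ 2) (m := α ^ 2 / (2 * β ^ 2)) hr ha.le
    (by field_simp; norm_num)
  have hfar : ∫⁻ s in Set.Ioi (α ^ 2 / (2 * β ^ 2)), ENNReal.ofReal
      ((√s ^ d)⁻¹ * Real.exp (-((α ^ 2 - s * β ^ 2) ^ 2 / (16 * s))))
      ≤ ENNReal.ofReal ((√(α ^ 2 / (2 * β ^ 2)) ^ d)⁻¹ *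
        (√(Real.pi / (β ^ 6 / (32 * α ^ 2))) + 64 / β ^ 4)) := by
    -- The Gaussian dominates for `s < 2r/a`, where `1/s` is bounded below, and the exponential
    -- dominates beyond; their sum dominates throughout.
    refine setLIntegral_ofReal_mono_const_mul (h := fun s =>
      Real.exp (-(β ^ 6 / (32 * α ^ 2)) * (s - α ^ 2 / β ^ 2) ^ 2) + Real.exp (-(β ^ 4 / 64) * s))
      measurableSet_Ioi (by positivity) ?_ ?_
    · intro s hs
      have hs' : α ^ 2 / (2 * β ^ 2) < s := hs
      have hs0 : 0 < s := hm.trans hs'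
      refine (weight_mul_exp_le d hm hs'.le).trans ?_
      gcongr
      rcases le_or_gt (2 * α ^ 2) (s * β ^ 2) with h | h
      · have h1 := mul_sq_le_of_far hs0 hr h
        have h2 := Real.exp_le_exp.2 (show -((α ^ 2 - s * β ^ 2) ^ 2 / (16 * s))
          ≤ -(β ^ 4 / 64) * s by ring_nf at h1 ⊢; linarith)
        linarith [Real.exp_pos (-(β ^ 6 / (32 * α ^ 2)) * (s - α ^ 2 / β ^ 2) ^ 2)]
      · have h1 : β ^ 6 / (32 * α ^ 2) * (s - α ^ 2 / β ^ 2) ^ 2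
            ≤ (α ^ 2 - s * β ^ 2) ^ 2 / (16 * s) := by
          have : β ^ 6 / (32 * α ^ 2) * (s - α ^ 2 / β ^ 2) ^ 2
            = (α ^ 2 - s * β ^ 2) ^ 2 / (16 * (2 * α ^ 2 / β ^ 2)) := by field_simp; ring
          rw [this]
          gcongr
          rw [le_div_iff₀ (by positivity)]; exact h.le
        have h2 := Real.exp_le_exp.2 (show -((α ^ 2 - s * β ^ 2) ^ 2 / (16 * s))
          ≤ -(β ^ 6 / (32 * α ^ 2)) * (s - α ^ 2 / β ^ 2) ^ 2 by linarith)
        linarith [Real.exp_pos (-(β ^ 4 / 64) * s)]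
    · have e : ∀ s : ℝ, ENNReal.ofReal (Real.exp (-(β ^ 6 / (32 * α ^ 2)) * (s - α ^ 2 / β ^ 2) ^ 2)
          + Real.exp (-(β ^ 4 / 64) * s)) = ENNReal.ofReal (Real.exp (-(β ^ 6 / (32 * α ^ 2)) *
          (s - α ^ 2 / β ^ 2) ^ 2)) + ENNReal.ofReal (Real.exp (-(β ^ 4 / 64) * s)) := fun s =>
        ENNReal.ofReal_add (Real.exp_pos _).le (Real.exp_pos _).le
      simp only [e]
      rw [lintegral_add_left (by fun_prop), ENNReal.ofReal_add (by positivity) (by positivity)]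
      gcongr
      · refine (setLIntegral_le_lintegral _ _).trans ?_
        rw [lintegral_exp_neg_mul_sub_sq (by positivity)]
      · have h := setLIntegral_exp_neg_mul_le hm.le (show 0 < β ^ 4 / 64 by positivity)
        rwa [one_div_div] at h
  refine (setLIntegral_le_add_of_subset (fun s hs => ?_) (by positivity) (by positivity)
    hnear hfar).trans (ENNReal.ofReal_le_ofReal ?_)
  · rcases le_or_gt s (α ^ 2 / (2 * β ^ 2)) with h | h
    · exact Or.inl ⟨hs, h⟩
    · exact Or.inr h
  · rw [peak_sq hα hβ, add_mul]
    refine add_le_add ?_ ?_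
    · have : (α ^ 2) ^ d = α ^ d * α ^ d := by rw [← mul_pow]; congr 1; ring
      rw [div_mul_eq_mul_div, mul_div_assoc]
      gcongr
      rw [this, div_pow, div_div, div_mul_div_comm, div_le_div_iff₀ (by positivity) (by positivity)]
      -- The early part is at most a constant times `(r a)^((1 - d)/2)` times the peak; this factor
      -- is at most 1 because `d ≥ 1` and `r a ≥ 1`.
      have h5 : α * β ≤ (α * β) ^ d := le_self_pow₀ h4 (by omega)
      rw [mul_pow] at h5
      nlinarith [mul_le_mul_of_nonneg_left h5 (show 0 ≤ α * β ^ 2 * α ^ d by positivity),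
        show 0 ≤ α * β ^ d * (2 * β ^ 2 * (α ^ d * α ^ d)) by positivity]
    · have h1 : √(Real.pi / (β ^ 6 / (32 * α ^ 2))) ≤ 11 * (α / β ^ 3) := by
        apply Real.sqrt_le_iff.2 ⟨by positivity, ?_⟩
        rw [show Real.pi / (β ^ 6 / (32 * α ^ 2)) = (32 * Real.pi) * (α / β ^ 3) ^ 2 by
          field_simp, mul_pow]
        gcongr
        nlinarith [Real.pi_lt_d2]
      have h2 : 64 / β ^ 4 ≤ 64 * (α / β ^ 3) := by
        rw [div_le_iff₀ (by positivity)]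
        have : 64 * (α / β ^ 3) * β ^ 4 = 64 * (α * β) := by field_simp
        rw [this]; linarith
      have h3 : (√(α ^ 2 / (2 * β ^ 2)) ^ d)⁻¹ ≤ 2 ^ d * (β / α) ^ d := by
        rw [← mul_pow, ← inv_pow]
        have : α / (2 * β) ≤ √(α ^ 2 / (2 * β ^ 2)) := by
          apply Real.le_sqrt_of_sq_le
          rw [div_pow, mul_pow]; gcongr; norm_num
        gcongr
        calc _ ≤ (α / (2 * β))⁻¹ := by gcongr
          _ = _ := by field_simp
      calc _ ≤ 2 ^ d * (β / α) ^ d * (11 * (α / β ^ 3) + 64 * (α / β ^ 3)) := by gcongr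
        _ = _ := by ring

lemma log_two_le_krad_two {r a t : ℝ} (h : 0 < r * a) (h1 : r * a ≤ 1) :
    1 / 2 ≤ krad 2 t r a := by
  rw [krad_two]
  have h3 : 1 ≤ 1 / √(r * a) := by
    rw [le_div_iff₀ (Real.sqrt_pos.2 h), one_mul]; exact Real.sqrt_le_one.2 h1
  have : Real.log 2 ≤ Real.log (1 + 1 / √(r * a)) := Real.log_le_log (by norm_num) (by linarith)
  linarith [Real.log_two_gt_d9]

/-- For `r a < 1` the drift is not felt before time about `a⁻²`: the integral is that of `s^(-d/2)`
from about `r²` on, convergent at infinity for `d ≥ 3`, logarithmic up to `a⁻²` for `d = 2`, and of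
order `√(min t a⁻²)` for `d = 1`. The constant `16` leaves room for the loss of half the distance in
`driftKernel_le`. -/
lemma laplace_le_krad {d : ℕ} (hd : 1 ≤ d) : ∃ C : ℝ, 0 < C ∧ ∀ t r a : ℝ, 0 < t → 0 < r → 0 < a →
    r ≤ t * a →
    ∫⁻ s in Set.Ioo 0 (t / 2),
        ENNReal.ofReal ((√s ^ d)⁻¹ * Real.exp (-((r - s * a) ^ 2 / (16 * s))))
      ≤ ENNReal.ofReal (C * krad d t r a) := by
  suffices H : ∃ C : ℝ, 0 < C ∧ ∀ t r a : ℝ, 0 < t → 0 < r → 0 < a → r ≤ t * a → r * a < 1 →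
      ∫⁻ s in Set.Ioo 0 (t / 2),
        ENNReal.ofReal ((√s ^ d)⁻¹ * Real.exp (-((r - s * a) ^ 2 / (16 * s))))
      ≤ ENNReal.ofReal (C * krad d t r a) by
    obtain ⟨C₁, hC₁, h₁⟩ := laplace_le_peak hd
    obtain ⟨C₂, hC₂, h₂⟩ := H
    refine ⟨2 * C₁ + C₂, by positivity, fun t r a ht hr ha hrt => ?_⟩
    have hk := krad_nonneg d (t := t) (a := a) hr.le
    rcases le_or_gt 1 (r * a) with h | h
    · refine (lintegral_mono_set fun s hs => hs.1).trans ((h₁ r a hr ha h).trans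
        (ENNReal.ofReal_le_ofReal ?_))
      have := peak_le_krad hd ht hr ha h hrt
      nlinarith
    · refine (h₂ t r a ht hr ha hrt h).trans (ENNReal.ofReal_le_ofReal ?_)
      nlinarith
  rcases eq_one_or_two_or_add_three hd with rfl | rfl | ⟨k, rfl⟩
  · refine ⟨72, by norm_num, fun t r a ht hr ha hrt hra => ?_⟩
    have hle : ∀ m : ℝ, 0 ≤ m → ∫⁻ s in Set.Ioc 0 m, ENNReal.ofReal
        ((√s ^ 1)⁻¹ * Real.exp (-((r - s * a) ^ 2 / (16 * s)))) ≤ ENNReal.ofReal (2 * √m) := by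
      intro m hm
      rw [← setLIntegral_inv_sqrt hm]
      refine setLIntegral_mono' measurableSet_Ioc fun s hs => ENNReal.ofReal_le_ofReal ?_
      rw [pow_one]
      have := hs.1
      exact mul_le_of_le_one_right (by positivity) (Real.exp_le_one_iff.2
        (neg_nonpos.2 (by positivity)))
    have ht' := Real.sqrt_pos.2 ht
    have hq : 0 < √(1 + t * a ^ 2) := Real.sqrt_pos.2 (by positivity)
    rw [krad_one]
    rcases le_or_gt (t * a ^ 2) 4 with h | h
    · refine (lintegral_mono_set (t := Set.Ioc 0 t) fun s hs => ⟨hs.1, ?_⟩).trans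
        ((hle t ht.le).trans (ENNReal.ofReal_le_ofReal ?_))
      · linarith [hs.2]
      · have : √(1 + t * a ^ 2) ≤ 36 := Real.sqrt_le_iff.2 ⟨by norm_num, by linarith⟩
        rw [← mul_div_assoc, le_div_iff₀ hq]; nlinarith
    · have hm : 0 < 4 / a ^ 2 := by positivity
      have hsm : √(4 / a ^ 2) = 2 / a := by
        rw [show (4 : ℝ) / a ^ 2 = (2 / a) ^ 2 by rw [div_pow]; norm_num]
        exact Real.sqrt_sq (by positivity)
      refine (setLIntegral_le_add_of_subset (fun s hs => ?_) (by positivity) (by positivity)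
        (hle _ hm.le) (laplace_far 1 hr ha hm ?_)).trans (ENNReal.ofReal_le_ofReal ?_)
      · rcases le_or_gt s (4 / a ^ 2) with h | h
        · exact Or.inl ⟨hs.1, h⟩
        · exact Or.inr h
      · rw [show 4 / a ^ 2 * a = 4 / a by field_simp, le_div_iff₀ ha]; linarith
      · rw [hsm]
        have h1 : √(1 + t * a ^ 2) ≤ 2 * (√t * a) := by
          apply Real.sqrt_le_iff.2 ⟨by positivity, ?_⟩
          rw [mul_pow, mul_pow, Real.sq_sqrt ht.le]; linarith
        calc _ = 72 * (√t / (2 * (√t * a))) := by field_simp; norm_num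
          _ ≤ _ := by gcongr
  -- Here `39 = 7 + 32`: the logarithm of the middle range costs `3 + 4` copies of `krad`, and the
  -- tail `16` is at most `32 * krad` since `krad ≥ 1/2`.
  · refine ⟨8 ^ 2 * Nat.factorial 2 * Real.exp 1 + 39, by positivity, fun t r a ht hr ha hrt hra => ?_⟩
    have hρ : 0 < r * a := by positivity
    have hκ := log_two_le_krad_two (t := t) hρ hra.le
    have hm : 0 < r ^ 2 / 2 := by positivity
    have hm2 : 0 < 4 / a ^ 2 := by positivity
    have hmm : r ^ 2 / 2 ≤ 4 / a ^ 2 := by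
      rw [div_le_div_iff₀ (by norm_num) (by positivity)]; nlinarith
    have hmid : ∫⁻ s in Set.Ioc (r ^ 2 / 2) (4 / a ^ 2), ENNReal.ofReal
        ((√s ^ 2)⁻¹ * Real.exp (-((r - s * a) ^ 2 / (16 * s))))
        ≤ ENNReal.ofReal (Real.log (4 / a ^ 2 / (r ^ 2 / 2))) := by
      rw [← setLIntegral_inv hm hmm]
      refine setLIntegral_mono' measurableSet_Ioc fun s hs => ENNReal.ofReal_le_ofReal ?_
      have := hm.trans hs.1
      rw [Real.sq_sqrt this.le]
      exact mul_le_of_le_one_right (by positivity) (Real.exp_le_one_iff.2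
        (neg_nonpos.2 (by positivity)))
    have hlog0 : 0 ≤ Real.log (4 / a ^ 2 / (r ^ 2 / 2)) :=
      Real.log_nonneg (by rwa [le_div_iff₀ hm, one_mul])
    refine (setLIntegral_le_add_of_subset (fun s hs => ?_) (by positivity) (by positivity)
        (laplace_near 2 (m := r ^ 2 / 2) hr ha.le ?_)
        (setLIntegral_le_add_of_subset subset_rfl hlog0 (by positivity) hmid
        (laplace_far 2 hr ha hm2 ?_))).trans (ENNReal.ofReal_le_ofReal ?_)
    · rcases le_or_gt s (r ^ 2 / 2) with h | h
      · exact Or.inl ⟨hs.1, h⟩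
      · rcases le_or_gt s (4 / a ^ 2) with h' | h'
        · exact Or.inr (Or.inl ⟨h, h'⟩)
        · exact Or.inr (Or.inr h')
    · nlinarith
    · rw [show 4 / a ^ 2 * a = 4 / a by field_simp, le_div_iff₀ ha]; linarith
    · have hs : 0 < √(r * a) := Real.sqrt_pos.2 hρ
      have h1 : Real.log (4 / a ^ 2 / (r ^ 2 / 2)) ≤ 7 * krad 2 t r a := by
        rw [krad_two]
        have e : 4 / a ^ 2 / (r ^ 2 / 2) = 2 ^ 3 * (1 / √(r * a)) ^ 4 := by
          have : √(r * a) ^ 4 = (r * a) ^ 2 := by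
            rw [show (4 : ℕ) = 2 * 2 by norm_num, pow_mul, Real.sq_sqrt hρ.le]
          rw [div_pow, this]; field_simp; norm_num
        have h3 : 1 ≤ 1 / √(r * a) := by
          rw [le_div_iff₀ hs, one_mul]; exact Real.sqrt_le_one.2 hra.le
        rw [e, Real.log_mul (by norm_num) (by positivity), Real.log_pow, Real.log_pow]
        have h5 : Real.log 2 ≤ Real.log (1 + 1 / √(r * a)) :=
          Real.log_le_log (by norm_num) (by linarith)
        have h6 : Real.log (1 / √(r * a)) ≤ Real.log (1 + 1 / √(r * a)) :=
          Real.log_le_log (by positivity) (by linarith)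
        push_cast; linarith
      have h2 : (√(4 / a ^ 2) ^ 2)⁻¹ * (64 / a ^ 2) = 16 := by
        rw [Real.sq_sqrt hm2.le]; field_simp; norm_num
      rw [h2, show 8 ^ 2 * (Nat.factorial 2 : ℝ) * Real.exp 1 / r ^ 2 * (r ^ 2 / 2)
        = 8 ^ 2 * (Nat.factorial 2 : ℝ) * Real.exp 1 * (1 / 2) by field_simp]
      have h7 := mul_le_mul_of_nonneg_left hκ
        (show 0 ≤ 8 ^ 2 * (Nat.factorial 2 : ℝ) * Real.exp 1 by positivity)
      rw [add_mul]
      linarith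
  · refine ⟨8 ^ (k + 3) * (k + 3).factorial * Real.exp 1 + 2 ^ (k + 2), by positivity,
      fun t r a ht hr ha hrt hra => ?_⟩
    have hm : 0 < r ^ 2 / 2 := by positivity
    refine (setLIntegral_le_add_of_subset (fun s hs => ?_) (by positivity) (by positivity)
        (laplace_near (k + 3) (m := r ^ 2 / 2) hr ha.le ?_)
        ((setLIntegral_mono' measurableSet_Ioi fun s hs => ENNReal.ofReal_le_ofReal ?_).trans
          (setLIntegral_inv_sqrt_pow_le hm k))).trans (ENNReal.ofReal_le_ofReal ?_)
    · rcases le_or_gt s (r ^ 2 / 2) with h | h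
      · exact Or.inl ⟨hs.1, h⟩
      · exact Or.inr h
    · nlinarith
    · have : 0 < s := hm.trans hs
      exact mul_le_of_le_one_right (by positivity) (Real.exp_le_one_iff.2
        (neg_nonpos.2 (by positivity)))
    · rw [krad_add_three]
      have h1 : 1 ≤ √(1 + r * a) ^ k := one_le_pow₀ (Real.one_le_sqrt.2 (by nlinarith))
      have h2 : r / 2 ≤ √(r ^ 2 / 2) := Real.le_sqrt_of_sq_le (by nlinarith)
      have h3 : 2 / √(r ^ 2 / 2) ^ (k + 1) ≤ 2 ^ (k + 2) * (1 / r ^ (k + 1)) := by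
        calc _ ≤ 2 / (r / 2) ^ (k + 1) := by gcongr
          _ = _ := by rw [div_pow]; field_simp; ring
      have h4 : 8 ^ (k + 3) * ((k + 3).factorial : ℝ) * Real.exp 1 / r ^ (k + 3) * (r ^ 2 / 2)
          ≤ 8 ^ (k + 3) * ((k + 3).factorial : ℝ) * Real.exp 1 * (1 / r ^ (k + 1)) := by
        rw [show 8 ^ (k + 3) * ((k + 3).factorial : ℝ) * Real.exp 1 / r ^ (k + 3) * (r ^ 2 / 2)
          = 8 ^ (k + 3) * ((k + 3).factorial : ℝ) * Real.exp 1 * (1 / r ^ (k + 1)) / 2 by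
            field_simp; ring]
        exact half_le_self (by positivity)
      calc _ ≤ (8 ^ (k + 3) * ((k + 3).factorial : ℝ) * Real.exp 1 + 2 ^ (k + 2))
            * (1 / r ^ (k + 1)) := by linarith
        _ ≤ _ := by gcongr

/-! ### Lower bounds for the Laplace integral. -/

/-- A window of relative width `δ = 1/(8√(r b))` just before the peak time already suffices: there
the exponent is at most 1 and the weight is at least its value at `r/b`. -/
lemma peak_le_laplace (d : ℕ) {r b : ℝ} (hr : 0 < r) (hb : 0 < b) (hrb : 1 / 16 ≤ r * b)
    {A : Set ℝ} (hA : Set.Ioo (r / (2 * b)) (r / b) ⊆ A) :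
    ENNReal.ofReal (Real.exp (-1) / 8 * peak d r b) ≤
      ∫⁻ s in A, ENNReal.ofReal ((√s ^ d)⁻¹ * Real.exp (-((r - s * b) ^ 2 / (2 * s)))) := by
  have hρ : 1 / 4 ≤ √(r * b) := Real.le_sqrt_of_sq_le (by linarith)
  have hρ0 : 0 < √(r * b) := by linarith
  have hδ : 1 / (8 * √(r * b)) ≤ 1 / 2 := by
    rw [div_le_div_iff₀ (by positivity) (by norm_num)]; linarith
  have hδ0 : 0 < 1 / (8 * √(r * b)) := by positivity
  obtain ⟨δ, hδe⟩ : ∃ δ, δ = 1 / (8 * √(r * b)) := ⟨_, rfl⟩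
  rw [← hδe] at hδ hδ0
  have hq : 0 < r / b := by positivity
  have hδ2 : δ ^ 2 * (64 * (r * b)) = 1 := by
    rw [hδe, div_pow, mul_pow, Real.sq_sqrt (by positivity)]; field_simp; norm_num
  have hlow : r / (2 * b) ≤ r / b * (1 - δ) := by
    rw [show r / (2 * b) = r / b * (1 / 2) by field_simp]; gcongr; linarith
  convert ofReal_mul_sub_le_setLIntegral (x := r / b * (1 - δ)) (y := r / b) (A := A)
    (f := fun s => (√s ^ d)⁻¹ * Real.exp (-((r - s * b) ^ 2 / (2 * s))))
    (c := (√(r / b) ^ d)⁻¹ * Real.exp (-1)) (by positivity) ?_ ?_ using 2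
  · rw [peak, show r / b - r / b * (1 - δ) = r / b * δ by ring, hδe]; field_simp
  · exact (Set.Ioo_subset_Ioo_left hlow).trans hA
  · intro s hs
    have hs1 : r / (2 * b) < s := hlow.trans_lt hs.1
    have hs0 : 0 < s := lt_trans (by positivity) hs1
    have hsb : s * b < r := by have := hs.2; rwa [lt_div_iff₀ hb] at this
    have hsb2 : r - s * b ≤ r * δ := by
      have := hs.1
      rw [div_mul_eq_mul_div, div_lt_iff₀ hb] at this; nlinarith
    have hs2 : r ≤ 2 * b * s := by
      rw [div_lt_iff₀ (by positivity)] at hs1; linarith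
    have hsq := Real.sqrt_pos.2 hs0
    have := hs.2.le
    have h1 : (r - s * b) ^ 2 / (2 * s) ≤ 1 := by
      rw [div_le_one (by positivity)]
      have h2 : (r - s * b) ^ 2 ≤ (r * δ) ^ 2 := by
        apply pow_le_pow_left₀ (by linarith) hsb2
      have h3 : (r * δ) ^ 2 * (64 * b) = r := by
        calc _ = r * (δ ^ 2 * (64 * (r * b))) := by ring
          _ = r := by rw [hδ2, mul_one]
      have h4 : (r * δ) ^ 2 * (64 * b) ≤ (2 * s) * (64 * b) := by nlinarith
      have h5 := le_of_mul_le_mul_right h4 (by positivity)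
      linarith
    gcongr

/-- Prepares the lower bound for `K`, in which the drift is halved. -/
lemma krad_le_half {d : ℕ} (hd : 1 ≤ d) {t r a : ℝ} (ht : 0 < t) (hr : 0 < r) (ha : 0 < a) :
    krad d t r a ≤ 2 ^ d * krad d t r (a / 2) := by
  have hk := krad_nonneg d (t := t) (a := a / 2) hr.le
  rcases eq_one_or_two_or_add_three hd with rfl | rfl | ⟨k, rfl⟩
  · refine le_trans ?_ (show krad 1 t r (a / 2) ≤ _ by nlinarith)
    rw [krad_one, krad_one]
    gcongr
    linarith
  · refine le_trans ?_ (show krad 2 t r (a / 2) ≤ _ by nlinarith)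
    rw [krad_two, krad_two]
    have : 0 < √(r * (a / 2)) := Real.sqrt_pos.2 (by positivity)
    gcongr
    linarith
  · rw [krad_add_three, krad_add_three, ← mul_div_assoc]
    gcongr
    calc √(1 + r * a) ^ k ≤ (2 * √(1 + r * (a / 2))) ^ k := by
          gcongr
          apply Real.sqrt_le_iff.2 ⟨by positivity, ?_⟩
          rw [mul_pow, Real.sq_sqrt (by positivity)]; nlinarith [mul_pos hr ha]
      _ = 2 ^ k * √(1 + r * (a / 2)) ^ k := mul_pow _ _ _
      _ ≤ _ := by gcongr <;> norm_num

lemma krad_add_three_le (k : ℕ) {t r a : ℝ} (hr : 0 < r) (hra : r * a ≤ 1) :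
    krad (k + 3) t r a ≤ 2 ^ k / r ^ (k + 1) := by
  rw [krad_add_three]
  have : √(1 + r * a) ≤ 2 := Real.sqrt_le_iff.2 ⟨by norm_num, by linarith⟩
  gcongr

lemma ofReal_const_mul_le_of_le {c x y : ℝ} {z : ℝ≥0∞} (h : ENNReal.ofReal y ≤ z)
    (hxy : c * x ≤ y) : ENNReal.ofReal (c * x) ≤ z :=
  (ENNReal.ofReal_le_ofReal hxy).trans h

/-- When `t a² ≤ 1`, the constraint `r ≤ t a` forces `r² ≤ t`, so driftless diffusion reaches
distance `r` by time `t`. -/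
lemma krad_le_laplace_zero {d : ℕ} (hd : 1 ≤ d) : ∃ c : ℝ, 0 < c ∧ ∀ t r a : ℝ, 0 < t → 0 < r →
    0 < a → t * a ^ 2 ≤ 1 → r ≤ t * a →
    ENNReal.ofReal (c * krad d t r a) ≤ ∫⁻ s in Set.Ioo 0 (t / 2),
      ENNReal.ofReal ((√s ^ d)⁻¹ * Real.exp (-(r ^ 2 / (2 * s)))) := by
  rcases eq_one_or_two_or_add_three hd with rfl | rfl | ⟨k, rfl⟩
  · refine ⟨Real.exp (-2) / 4, by positivity, fun t r a ht hr ha hta hrt => ?_⟩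
    have hr2 : r ^ 2 ≤ t := by nlinarith [mul_pos ht ha]
    have htq := Real.sqrt_pos.2 ht
    refine ofReal_const_mul_le_of_le (ofReal_mul_sub_le_setLIntegral (x := t / 4) (y := t / 2)
      (c := (√t)⁻¹ * Real.exp (-2)) (by positivity)
      (Set.Ioo_subset_Ioo_left (by positivity)) ?_) ?_
    · intro s hs
      have hs0 : 0 < s := lt_trans (by positivity) hs.1
      have := Real.sqrt_pos.2 hs0
      have h1 : s ≤ t := by linarith [hs.2]
      have h2 : r ^ 2 / (2 * s) ≤ 2 := by
        rw [div_le_iff₀ (by positivity)]; linarith [hs.1]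
      rw [pow_one]
      gcongr
    · rw [krad_one]
      have : 1 ≤ √(1 + t * a ^ 2) := Real.one_le_sqrt.2 (by nlinarith [sq_nonneg a])
      calc Real.exp (-2) / 4 * (√t / √(1 + t * a ^ 2)) ≤ Real.exp (-2) / 4 * (√t / 1) := by gcongr
        _ = (√t)⁻¹ * Real.exp (-2) * (√t ^ 2 / 4) := by field_simp
        _ = _ := by rw [Real.sq_sqrt ht.le]; ring
  · refine ⟨Real.exp (-2), by positivity, fun t r a ht hr ha hta hrt => ?_⟩
    have hr2 : r ^ 2 ≤ t := by nlinarith [mul_pos ht ha]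
    refine ofReal_const_mul_le_of_le (ofReal_mul_log_le_setLIntegral (x := r ^ 2 / 4) (y := t / 2)
      (c := Real.exp (-2)) (by positivity) (by positivity) (by linarith)
      (Set.Ioo_subset_Ioo_left (by positivity)) ?_) ?_
    · intro s hs
      have hs0 : 0 < s := lt_trans (by positivity) hs.1
      have h2 : r ^ 2 / (2 * s) ≤ 2 := by
        rw [div_le_iff₀ (by positivity)]; linarith [hs.1]
      rw [Real.sq_sqrt hs0.le, mul_comm]
      gcongr
    · rw [krad_two]
      have hρ := Real.sqrt_pos.2 (mul_pos hr ha)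
      gcongr
      obtain ⟨q, hq⟩ : ∃ q, q = √t / r := ⟨_, rfl⟩
      have hq1 : 1 ≤ q := by
        rw [hq, le_div_iff₀ hr, one_mul]; exact Real.le_sqrt_of_sq_le hr2
      -- This is `r ≤ t a` rewritten; it trades the logarithm in `r a` for one in `√t / r`.
      have h1 : 1 / √(r * a) ≤ q := by
        rw [hq, div_le_div_iff₀ hρ hr, one_mul, ← Real.sqrt_mul ht.le]
        apply Real.le_sqrt_of_sq_le
        nlinarith
      have h2 : t / 2 / (r ^ 2 / 4) = 2 * q ^ 2 := by
        rw [hq, div_pow, Real.sq_sqrt ht.le]; field_simp; norm_num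
      rw [h2]; nlinarith
  · refine ⟨Real.exp (-2) / 4 / 2 ^ k, by positivity, fun t r a ht hr ha hta hrt => ?_⟩
    have hr2 : r ^ 2 ≤ t := by nlinarith [mul_pos ht ha]
    refine ofReal_const_mul_le_of_le (ofReal_mul_sub_le_setLIntegral (x := r ^ 2 / 4)
      (y := r ^ 2 / 2) (c := (r ^ (k + 3))⁻¹ * Real.exp (-2)) (by positivity)
      (Set.Ioo_subset_Ioo (by positivity) (by linarith)) ?_) ?_
    · intro s hs
      have hs0 : 0 < s := lt_trans (by positivity) hs.1
      have := Real.sqrt_pos.2 hs0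
      have h1 : √s ≤ r := Real.sqrt_le_iff.2 ⟨hr.le, by nlinarith [hs.2]⟩
      have h2 : r ^ 2 / (2 * s) ≤ 2 := by
        rw [div_le_iff₀ (by positivity)]; linarith [hs.1]
      gcongr
    · have := krad_add_three_le k (t := t) hr (a := a) (by nlinarith)
      calc _ ≤ Real.exp (-2) / 4 / 2 ^ k * (2 ^ k / r ^ (k + 1)) := by gcongr
        _ = _ := by field_simp; ring

/-- For `r b ≥ 1` the peak time `r/b` lies within `(0, t/2)`. Otherwise a time window with bounded
exponent is enough: around `b⁻²` for `d = 1`, from `r²/2` to `r/b` for `d = 2`, around `r²` for `d ≥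
3`. -/
lemma krad_le_laplace {d : ℕ} (hd : 1 ≤ d) : ∃ c : ℝ, 0 < c ∧ ∀ t r b : ℝ, 0 < t → 0 < r →
    0 < b → 1 ≤ 4 * (t * b ^ 2) → r ≤ t * b / 2 →
    ENNReal.ofReal (c * krad d t r b) ≤ ∫⁻ s in Set.Ioo 0 (t / 2),
      ENNReal.ofReal ((√s ^ d)⁻¹ * Real.exp (-((r - s * b) ^ 2 / (2 * s)))) := by
  suffices H : ∃ c : ℝ, 0 < c ∧ ∀ t r b : ℝ, 0 < t → 0 < r → 0 < b → 1 ≤ 4 * (t * b ^ 2) →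
      r ≤ t * b / 2 → r * b < 1 →
      ENNReal.ofReal (c * krad d t r b) ≤ ∫⁻ s in Set.Ioo 0 (t / 2),
      ENNReal.ofReal ((√s ^ d)⁻¹ * Real.exp (-((r - s * b) ^ 2 / (2 * s)))) by
    obtain ⟨c, hc, h⟩ := H
    refine ⟨min c (Real.exp (-1) / 8 / 5 ^ d), by positivity, fun t r b ht hr hb htb hrt => ?_⟩
    have hk := krad_nonneg d (t := t) (a := b) hr.le
    rcases le_or_gt 1 (r * b) with h1 | h1
    · refine ofReal_const_mul_le_of_le (peak_le_laplace d hr hb (by linarith) ?_) ?_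
      · refine Set.Ioo_subset_Ioo (by positivity) ?_
        rw [div_le_iff₀ hb]; linarith
      · have := krad_le_peak hd ht hr hb (by linarith)
        calc _ ≤ Real.exp (-1) / 8 / 5 ^ d * (5 ^ d * peak d r b) := by
              gcongr
              exact min_le_right _ _
          _ = _ := by field_simp
    · refine ofReal_const_mul_le_of_le (h t r b ht hr hb htb hrt h1) ?_
      gcongr
      exact min_le_left _ _
  rcases eq_one_or_two_or_add_three hd with rfl | rfl | ⟨k, rfl⟩
  · refine ⟨Real.exp (-8) / 16, by positivity, fun t r b ht hr hb htb hrt hrb => ?_⟩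
    have htq := Real.sqrt_pos.2 ht
    refine ofReal_const_mul_le_of_le (ofReal_mul_sub_le_setLIntegral (x := 1 / (16 * b ^ 2))
      (y := 1 / (8 * b ^ 2)) (c := b * Real.exp (-8)) (by positivity)
      (Set.Ioo_subset_Ioo (by positivity) ?_) ?_) ?_
    · rw [div_le_div_iff₀ (by positivity) (by norm_num)]; linarith
    · intro s hs
      have hs0 : 0 < s := lt_trans (by positivity) hs.1
      have hs1 := hs.1
      have hs2 := hs.2
      rw [div_lt_iff₀ (by positivity)] at hs1
      rw [lt_div_iff₀ (by positivity)] at hs2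
      have hq := Real.sqrt_pos.2 hs0
      have h1 : √s ≤ b⁻¹ := Real.sqrt_le_iff.2 ⟨by positivity, by
        rw [inv_pow, ← one_div, le_div_iff₀ (by positivity)]; nlinarith [mul_pos hs0 (pow_pos hb 2)]⟩
      have h2 : (r - s * b) ^ 2 / (2 * s) ≤ 8 := by
        rw [div_le_iff₀ (by positivity)]
        have h3 : (r - s * b) ^ 2 * b ^ 2 ≤ 1 := by
          rw [← mul_pow, sq_le_one_iff_abs_le_one, abs_le]
          constructor <;> nlinarith [mul_pos hs0 hb, mul_pos hr hb]
        have h4 : (r - s * b) ^ 2 * b ^ 2 ≤ 8 * (2 * s) * b ^ 2 := by linarith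
        exact le_of_mul_le_mul_right h4 (by positivity)
      rw [pow_one]
      have h5 : b ≤ (√s)⁻¹ := by rwa [le_inv_comm₀ hb hq]
      gcongr
    · rw [krad_one]
      have h5 : √t * b ≤ √(1 + t * b ^ 2) := by
        apply Real.le_sqrt_of_sq_le
        rw [mul_pow, Real.sq_sqrt ht.le]; linarith
      calc _ ≤ Real.exp (-8) / 16 * (√t / (√t * b)) := by gcongr
        _ = _ := by field_simp; norm_num
  · refine ⟨Real.exp (-1), by positivity, fun t r b ht hr hb htb hrt hrb => ?_⟩
    have hρ := Real.sqrt_pos.2 (mul_pos hr hb)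
    refine ofReal_const_mul_le_of_le (ofReal_mul_log_le_setLIntegral (x := r ^ 2 / 2) (y := r / b)
      (c := Real.exp (-1)) (by positivity) (by positivity) ?_
      (Set.Ioo_subset_Ioo (by positivity) ?_) ?_) ?_
    · rw [le_div_iff₀ hb]; nlinarith
    · rw [div_le_iff₀ hb]; linarith
    · intro s hs
      have hs0 : 0 < s := lt_trans (by positivity) hs.1
      have hsb := hs.2
      rw [lt_div_iff₀ hb] at hsb
      have h2 : (r - s * b) ^ 2 / (2 * s) ≤ 1 := by
        rw [div_le_iff₀ (by positivity)]; nlinarith [hs.1, mul_pos hs0 hb]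
      rw [Real.sq_sqrt hs0.le, mul_comm]
      gcongr
    · rw [krad_two]
      gcongr
      have h2 : r / b / (r ^ 2 / 2) = 2 / √(r * b) ^ 2 := by
        rw [Real.sq_sqrt (by positivity)]; field_simp
      have h3 : √(r * b) ≤ 1 := Real.sqrt_le_one.2 hrb.le
      rw [h2, le_div_iff₀ (by positivity)]
      have : (1 + 1 / √(r * b)) * √(r * b) ^ 2 = √(r * b) ^ 2 + √(r * b) := by field_simp
      rw [this]; nlinarith
  · refine ⟨Real.exp (-1) / 2 / 2 ^ k, by positivity, fun t r b ht hr hb htb hrt hrb => ?_⟩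
    have hrb' : r ^ 2 ≤ t / 2 := by
      have : r * (r * b) ≤ r * 1 := by gcongr
      have : r ^ 2 * b ≤ t / 2 * b := by linarith
      exact le_of_mul_le_mul_right this hb
    refine ofReal_const_mul_le_of_le (ofReal_mul_sub_le_setLIntegral (x := r ^ 2 / 2)
      (y := r ^ 2) (c := (r ^ (k + 3))⁻¹ * Real.exp (-1)) (by positivity)
      (Set.Ioo_subset_Ioo (by positivity) hrb') ?_) ?_
    · intro s hs
      have hs0 : 0 < s := lt_trans (by positivity) hs.1
      have := Real.sqrt_pos.2 hs0
      have h1 : √s ≤ r := Real.sqrt_le_iff.2 ⟨hr.le, hs.2.le⟩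
      have hsb : s * b < r := by
        calc s * b ≤ r ^ 2 * b := by gcongr; exact hs.2.le
          _ = r * (r * b) := by ring
          _ < r * 1 := by gcongr
          _ = r := mul_one r
      have h2 : (r - s * b) ^ 2 / (2 * s) ≤ 1 := by
        rw [div_le_iff₀ (by positivity)]; nlinarith [hs.1, mul_pos hs0 hb]
      gcongr
    · have := krad_add_three_le k (t := t) hr hrb.le
      calc _ ≤ Real.exp (-1) / 2 / 2 ^ k * (2 ^ k / r ^ (k + 1)) := by gcongr
        _ = _ := by field_simp; ring

/-! ### Pointwise comparison of `K` with drifting heat kernels. -/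

/-- The last term does not depend on `s`. It equals the exponent of `K` for `c = 4` with drift `w`,
and also for `c = 2` with drift `w/2`. -/
lemma norm_sub_smul_sq_div {d : ℕ} (ζ w : EuclideanSpace ℝ (Fin d)) {s c : ℝ} (hs : s ≠ 0)
    (hc : c ≠ 0) : ‖ζ - s • w‖ ^ 2 / (c * s) =
      (‖ζ‖ - s * ‖w‖) ^ 2 / (c * s) + 2 * (‖ζ‖ * ‖w‖ - inner ℝ ζ w) / c := by
  rw [norm_sub_sq_real, inner_smul_right, norm_smul, mul_pow, Real.norm_eq_abs, sq_abs]
  field_simp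
  ring

lemma K_eq {d : ℕ} (hd : 1 ≤ d) {t : ℝ} (ht : 0 ≤ t) (ζ w : EuclideanSpace ℝ (Fin d)) :
    K t ζ w = if ‖ζ‖ ≤ t * ‖w‖ then
      Real.exp (-((‖ζ‖ * ‖w‖ - inner ℝ ζ w) / 2)) * krad d t ‖ζ‖ ‖w‖ else 0 := by
  unfold K
  congr 2
  · rw [neg_div]
  · rcases eq_one_or_two_or_add_three hd with rfl | rfl | ⟨k, rfl⟩
    · rw [krad_one, if_neg (by norm_num), if_neg (by norm_num), Real.rpow_neg (by positivity),
        ← Real.sqrt_eq_rpow, ← div_eq_mul_inv]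
    · rw [krad_two, if_neg (by norm_num), if_pos rfl]
    · have h1 : ‖ζ‖ ^ (((k + 3 : ℕ) : ℝ) - 2) = ‖ζ‖ ^ (k + 1) := by
        rw [← Real.rpow_natCast]; congr 1; push_cast; ring
      have h2 : (1 + ‖ζ‖ * ‖w‖) ^ (((k + 3 : ℕ) : ℝ) / 2 - 3 / 2) = √(1 + ‖ζ‖ * ‖w‖) ^ k := by
        rw [Real.sqrt_eq_rpow, ← Real.rpow_natCast, ← Real.rpow_mul (by positivity)]
        congr 1; push_cast; ring
      rw [krad_add_three, if_pos (by omega), h1, h2]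
      ring

lemma K_nonneg {d : ℕ} (hd : 1 ≤ d) {t : ℝ} (ht : 0 ≤ t) (ζ w : EuclideanSpace ℝ (Fin d)) :
    0 ≤ K t ζ w := by
  rw [K_eq hd ht]
  split_ifs
  · exact mul_nonneg (Real.exp_pos _).le (krad_nonneg d (norm_nonneg _))
  · exact le_rfl

lemma krad_mono {d : ℕ} (hd : 1 ≤ d) {t T r a : ℝ} (ht : 0 ≤ t) (htT : t ≤ T) :
    krad d t r a ≤ krad d T r a := by
  rcases eq_one_or_two_or_add_three hd with rfl | rfl | ⟨k, rfl⟩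
  · have hT := ht.trans htT
    have h1 : 0 < √(1 + t * a ^ 2) := Real.sqrt_pos.2 (by positivity)
    have h2 : 0 < √(1 + T * a ^ 2) := Real.sqrt_pos.2 (by positivity)
    rw [krad_one, krad_one, div_le_div_iff₀ h1 h2, ← Real.sqrt_mul ht, ← Real.sqrt_mul hT]
    apply Real.sqrt_le_sqrt
    nlinarith
  · rw [krad_two, krad_two]
  · rw [krad_add_three, krad_add_three]

lemma K_mono {d : ℕ} (hd : 1 ≤ d) {t T : ℝ} (ht : 0 ≤ t) (htT : t ≤ T)
    (ζ w : EuclideanSpace ℝ (Fin d)) : K t ζ w ≤ K T ζ w := by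
  by_cases h : ‖ζ‖ ≤ t * ‖w‖
  · have h' : ‖ζ‖ ≤ T * ‖w‖ := h.trans (by gcongr)
    rw [K_eq hd ht, K_eq hd (ht.trans htT), if_pos h, if_pos h']
    exact mul_le_mul_of_nonneg_left (krad_mono hd ht htT) (Real.exp_pos _).le
  · rw [K_eq hd ht, if_neg h]
    exact K_nonneg hd (ht.trans htT) _ _

lemma le_krad_inv_sqrt {d : ℕ} (hd : 1 ≤ d) {t r : ℝ} (ht : 0 < t) (hr : 0 < r) (hrt : r ≤ √t) :
    1 / 2 * (t / √t ^ d) ≤ krad d t r (1 / √t) := by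
  have hq := Real.sqrt_pos.2 ht
  rcases eq_one_or_two_or_add_three hd with rfl | rfl | ⟨k, rfl⟩
  · have e : 1 + t * (1 / √t) ^ 2 = 2 := by
      rw [div_pow, Real.sq_sqrt ht.le]; field_simp; norm_num
    have h2 : √2 ≤ 2 := Real.sqrt_le_iff.2 ⟨by norm_num, by norm_num⟩
    rw [krad_one, e, pow_one, Real.div_sqrt]
    calc 1 / 2 * √t = √t / 2 := by ring
      _ ≤ _ := by gcongr
  · rw [Real.sq_sqrt ht.le, div_self ht.ne', mul_one]
    refine log_two_le_krad_two (by positivity) ?_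
    rw [mul_one_div, div_le_one hq]; exact hrt
  · rw [krad_add_three]
    have h1 : 1 ≤ √(1 + r * (1 / √t)) ^ k :=
      one_le_pow₀ (Real.one_le_sqrt.2 (by linarith [show 0 < r * (1 / √t) by positivity]))
    calc 1 / 2 * (t / √t ^ (k + 3)) = 1 / 2 * (√t ^ 2 / √t ^ (k + 3)) := by rw [Real.sq_sqrt ht.le]
      _ = 1 / 2 * (1 / √t ^ (k + 1)) := by field_simp; ring
      _ ≤ 1 / √t ^ (k + 1) := by linarith [show 0 < 1 / √t ^ (k + 1) by positivity]
      _ ≤ _ := by gcongr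

/-- Since `‖ζ‖ ‖w‖ ≤ 1`, the angular exponential is at least `e⁻¹` whatever the direction of `w`. -/
lemma krad_le_K_of_norm_eq {d : ℕ} (hd : 1 ≤ d) {t : ℝ} (ht : 0 < t)
    {ζ w : EuclideanSpace ℝ (Fin d)} (hw : ‖w‖ = 1 / √t) (hζ : ‖ζ‖ ≤ √t) :
    krad d t ‖ζ‖ (1 / √t) ≤ Real.exp 1 * K t ζ w := by
  have hq := Real.sqrt_pos.2 ht
  have h1 : t * ‖w‖ = √t := by rw [hw, mul_one_div, Real.div_sqrt]
  rw [K_eq hd ht.le, h1, if_pos hζ, ← mul_assoc, ← Real.exp_add, hw]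
  refine le_mul_of_one_le_left (krad_nonneg d (norm_nonneg _)) (Real.one_le_exp ?_)
  have h2 := abs_real_inner_le_norm ζ w
  rw [abs_le, hw] at h2
  have h3 : ‖ζ‖ * (1 / √t) ≤ 1 := by rw [mul_one_div, div_le_one hq]; exact hζ
  linarith [h2.1]

/-- Time integral over `(0, t/2)` of (unnormalized) heat kernels with drift `w`. -/
noncomputable def driftKernel {d : ℕ} (c t : ℝ) (ζ w : EuclideanSpace ℝ (Fin d)) : ℝ≥0∞ :=
  ∫⁻ s in Set.Ioo 0 (t / 2), ENNReal.ofReal ((√s ^ d)⁻¹ * Real.exp (-(‖ζ - s • w‖ ^ 2 / (c * s))))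

/-- The three terms serve three regions: `‖ζ‖ ≤ t‖w‖`, where the Laplace bound applies; `t‖w‖ < ‖ζ‖
≤ √t`, where an auxiliary drift `w₀` of length `1/√t` replaces `w`; and larger `‖ζ‖`, where only a
Gaussian tail is left. -/
lemma driftKernel_le {d : ℕ} (hd : 1 ≤ d) : ∃ C : ℝ≥0∞, C ≠ ⊤ ∧
    ∀ (t : ℝ) (ζ w w₀ : EuclideanSpace ℝ (Fin d)), 0 < t → ζ ≠ 0 → ‖w₀‖ = 1 / √t →
      driftKernel 4 t ζ w ≤ C * (ENNReal.ofReal (K t ζ w) + ENNReal.ofReal (K t ζ w₀) +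
        ENNReal.ofReal (t / √t ^ d) * ENNReal.ofReal (Real.exp (-(‖ζ‖ ^ 2 / (64 * t))))) := by
  obtain ⟨C, hC, h⟩ := laplace_le_krad hd
  obtain ⟨B, hB⟩ : ∃ B : ℝ, B = 8 ^ d * d.factorial * Real.exp 1 := ⟨_, rfl⟩
  have hB0 : 0 < B := by rw [hB]; positivity
  refine ⟨ENNReal.ofReal (C + Real.exp 1 * (C * Real.exp 1) + B), ENNReal.ofReal_ne_top,
    fun t ζ w w₀ ht hζ hw₀ => ?_⟩
  have hr : 0 < ‖ζ‖ := norm_pos_iff.2 hζ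
  have hq := Real.sqrt_pos.2 ht
  rw [← ENNReal.ofReal_mul (by positivity), ← ENNReal.ofReal_add (K_nonneg hd ht.le _ _)
    (K_nonneg hd ht.le _ _), ← ENNReal.ofReal_add (add_nonneg (K_nonneg hd ht.le _ _)
    (K_nonneg hd ht.le _ _)) (by positivity), ← ENNReal.ofReal_mul (by positivity)]
  have hK1 := K_nonneg hd ht.le ζ w
  have hK2 := K_nonneg hd ht.le ζ w₀
  obtain ⟨G, hG⟩ : ∃ G : ℝ, G = t / √t ^ d * Real.exp (-(‖ζ‖ ^ 2 / (64 * t))) := ⟨_, rfl⟩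
  have hG0 : 0 < G := by rw [hG]; positivity
  rw [← hG]
  have hE := Real.exp_pos 1
  by_cases h1 : ‖ζ‖ ≤ t * ‖w‖
  · have ha : 0 < ‖w‖ := pos_of_mul_pos_right (hr.trans_le h1) ht.le
    refine (setLIntegral_ofReal_mono_const_mul measurableSet_Ioo (Real.exp_pos
      (-((‖ζ‖ * ‖w‖ - inner ℝ ζ w) / 2))).le ?_ (h t ‖ζ‖ ‖w‖ ht hr ha h1)).trans
      (ENNReal.ofReal_le_ofReal ?_)
    · intro s hs
      have hs0 := hs.1
      rw [norm_sub_smul_sq_div ζ w hs0.ne' (by norm_num), mul_left_comm, ← Real.exp_add]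
      gcongr
      have : (‖ζ‖ - s * ‖w‖) ^ 2 / (16 * s) ≤ (‖ζ‖ - s * ‖w‖) ^ 2 / (4 * s) := by
        gcongr; norm_num
      linarith
    · have e : K t ζ w = Real.exp (-((‖ζ‖ * ‖w‖ - inner ℝ ζ w) / 2)) * krad d t ‖ζ‖ ‖w‖ := by
        rw [K_eq hd ht.le, if_pos h1]
      calc _ = C * K t ζ w := by rw [e]; ring
        _ ≤ _ := by gcongr; · linarith [show 0 ≤ Real.exp 1 * (C * Real.exp 1) by positivity]
                    · linarith
  · push Not at h1
    -- Up to time `t/2` the drift covers less than half of `‖ζ‖`.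
    have hhalf : ∀ s ∈ Set.Ioc 0 (t / 2), ‖ζ‖ ^ 2 / (16 * s) ≤ ‖ζ - s • w‖ ^ 2 / (4 * s) := by
      intro s hs
      have hs0 := hs.1
      have h2 : ‖ζ‖ / 2 ≤ ‖ζ - s • w‖ := by
        have h3 := norm_sub_norm_le ζ (s • w)
        rw [norm_smul, Real.norm_of_nonneg hs0.le] at h3
        have h4 : s * ‖w‖ ≤ t / 2 * ‖w‖ := by gcongr; exact hs.2
        linarith
      calc ‖ζ‖ ^ 2 / (16 * s) = (‖ζ‖ / 2) ^ 2 / (4 * s) := by field_simp; norm_num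
        _ ≤ _ := by gcongr
    rcases le_or_gt ‖ζ‖ √t with h2 | h2
    · have hta : t * (1 / √t) = √t := by rw [mul_one_div, Real.div_sqrt]
      refine (setLIntegral_ofReal_mono_const_mul measurableSet_Ioo hE.le ?_
        (h t ‖ζ‖ (1 / √t) ht hr (by positivity) (by rwa [hta]))).trans
        (ENNReal.ofReal_le_ofReal ?_)
      · intro s hs
        have hs0 := hs.1
        have h3 := hhalf s ⟨hs0, hs.2.le⟩
        rw [mul_left_comm, ← Real.exp_add]
        gcongr
        -- Introducing the auxiliary drift changes the exponent by at most 1, since `s²/t ≤ s`.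
        have h4 : (‖ζ‖ - s * (1 / √t)) ^ 2 / (16 * s) ≤ ‖ζ‖ ^ 2 / (16 * s) + 1 := by
          rw [div_add' _ _ _ (by positivity)]
          gcongr
          have h5 : (s * (1 / √t)) ^ 2 ≤ s := by
            rw [mul_pow, div_pow, Real.sq_sqrt ht.le, one_pow, mul_one_div, div_le_iff₀ ht]
            nlinarith [hs.2]
          have h6 : 0 ≤ ‖ζ‖ * (s * (1 / √t)) := by positivity
          nlinarith
        linarith
      · have := krad_le_K_of_norm_eq hd ht hw₀ h2
        calc _ ≤ Real.exp 1 * (C * (Real.exp 1 * K t ζ w₀)) := by gcongr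
          _ = Real.exp 1 * (C * Real.exp 1) * K t ζ w₀ := by ring
          _ ≤ _ := by gcongr
                      · linarith
                      · linarith
    · refine (lintegral_mono_set Set.Ioo_subset_Ioc_self).trans
        ((setLIntegral_Ioc_le_ofReal_mul_sub
        (c := B / √t ^ d * Real.exp (-(‖ζ‖ ^ 2 / (64 * t)))) (by positivity) ?_).trans
        (ENNReal.ofReal_le_ofReal ?_))
      · intro s hs
        have hs0 := hs.1
        have hs2 := hs.2
        have h3 := hhalf s hs
        have h4 : ‖ζ‖ ^ 2 / (64 * t) ≤ ‖ζ‖ ^ 2 / (64 * s) := by gcongr; linarith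
        -- One share of the exponent absorbs the singular weight; the other survives as a Gaussian
        -- at scale `√t`.
        have h5 : ‖ζ‖ ^ 2 / (64 * s) + ‖ζ‖ ^ 2 / (64 * s) ≤ ‖ζ‖ ^ 2 / (16 * s) := by
          rw [← add_div, div_le_div_iff₀ (by positivity) (by positivity)]
          nlinarith [mul_pos hs0 (pow_pos hr 2)]
        have h6 : Real.exp (-(‖ζ - s • w‖ ^ 2 / (4 * s))) ≤ Real.exp (-(‖ζ‖ ^ 2 / (64 * s))) *
            Real.exp (-(‖ζ‖ ^ 2 / (64 * t))) := by
          rw [← Real.exp_add]; apply Real.exp_le_exp.2; linarith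
        have h7 := inv_sqrt_pow_mul_exp_le d hr hs0
        rw [← hB] at h7
        calc _ ≤ (√s ^ d)⁻¹ * (Real.exp (-(‖ζ‖ ^ 2 / (64 * s))) *
            Real.exp (-(‖ζ‖ ^ 2 / (64 * t)))) := by gcongr
          _ ≤ B / ‖ζ‖ ^ d * Real.exp (-(‖ζ‖ ^ 2 / (64 * t))) := by rw [← mul_assoc]; gcongr
          _ ≤ _ := by gcongr
      · calc _ = B * G / 2 := by rw [hG]; ring
          _ ≤ B * G := half_le_self (by positivity)
          _ ≤ _ := by gcongr
                      · linarith [show 0 ≤ Real.exp 1 * (C * Real.exp 1) by positivity]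
                      · linarith

lemma le_inv_mul_of_ofReal_mul_le {c x : ℝ} {y : ℝ≥0∞} (hc : 0 < c)
    (h : ENNReal.ofReal (c * x) ≤ y) : ENNReal.ofReal x ≤ ENNReal.ofReal c⁻¹ * y := by
  calc ENNReal.ofReal x = ENNReal.ofReal c⁻¹ * ENNReal.ofReal (c * x) := by
        rw [← ENNReal.ofReal_mul (by positivity), inv_mul_cancel_left₀ hc.ne']
    _ ≤ _ := by gcongr

lemma K_le_driftKernel_zero {d : ℕ} (hd : 1 ≤ d) : ∃ C : ℝ≥0∞, C ≠ ⊤ ∧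
    ∀ (t : ℝ) (ζ w : EuclideanSpace ℝ (Fin d)), 0 < t → ζ ≠ 0 → t * ‖w‖ ^ 2 ≤ 1 →
      ENNReal.ofReal (K t ζ w) ≤ C * driftKernel 2 t ζ 0 := by
  obtain ⟨c, hc, h⟩ := krad_le_laplace_zero hd
  refine ⟨ENNReal.ofReal c⁻¹, ENNReal.ofReal_ne_top, fun t ζ w ht hζ htw => ?_⟩
  have hr : 0 < ‖ζ‖ := norm_pos_iff.2 hζ
  rw [K_eq hd ht.le]
  split_ifs with h1
  · have ha : 0 < ‖w‖ := pos_of_mul_pos_right (hr.trans_le h1) ht.le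
    refine le_trans (ENNReal.ofReal_le_ofReal ?_)
      (le_inv_mul_of_ofReal_mul_le hc ((h t ‖ζ‖ ‖w‖ ht hr ha htw h1).trans_eq ?_))
    · refine mul_le_of_le_one_left (krad_nonneg d hr.le) (Real.exp_le_one_iff.2 ?_)
      linarith [real_inner_le_norm ζ w]
    · simp [driftKernel]
  · simp

/-- The bridge is bounded below only with `2 s` in the exponent, which would double the angular
exponent; halving the drift restores it. The halved drift travels only `t‖w‖/4` by time `t/2`, so
larger `‖ζ‖` are reached by the full drift at times in `(t/8, t)`. -/
lemma K_le_driftKernel {d : ℕ} (hd : 1 ≤ d) : ∃ C : ℝ≥0∞, C ≠ ⊤ ∧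
    ∀ (t : ℝ) (ζ w : EuclideanSpace ℝ (Fin d)), 0 < t → ζ ≠ 0 → 1 ≤ t * ‖w‖ ^ 2 →
      ENNReal.ofReal (K t ζ w) ≤ C * (driftKernel 2 t ζ ((1 / 2 : ℝ) • w) +
        ∫⁻ s in Set.Ioo (t / 8) t,
          ENNReal.ofReal ((√s ^ d)⁻¹ * Real.exp (-(‖ζ - s • w‖ ^ 2 / (4 * s))))) := by
  obtain ⟨c, hc, h⟩ := krad_le_laplace hd
  refine ⟨ENNReal.ofReal (c / 2 ^ d)⁻¹ + ENNReal.ofReal (Real.exp (-1) / 8 / 5 ^ d)⁻¹,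
    by simp, fun t ζ w ht hζ htw => ?_⟩
  have hr : 0 < ‖ζ‖ := norm_pos_iff.2 hζ
  have ha : 0 < ‖w‖ := by
    rcases (norm_nonneg w).eq_or_lt with h0 | h0
    · rw [← h0] at htw; norm_num at htw
    · exact h0
  have hb : ‖(1 / 2 : ℝ) • w‖ = ‖w‖ / 2 := by
    rw [norm_smul]; norm_num; ring
  rw [K_eq hd ht.le]
  split_ifs with h1
  swap
  · simp
  obtain ⟨e, he⟩ : ∃ e, e = Real.exp (-((‖ζ‖ * ‖w‖ - inner ℝ ζ w) / 2)) := ⟨_, rfl⟩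
  have he0 : 0 < e := he ▸ Real.exp_pos _
  rw [← he]
  have hmul : ∀ (A : Set ℝ) (f g : ℝ → ℝ) (x : ℝ), MeasurableSet A →
      (∀ s ∈ A, e * f s ≤ g s) → ENNReal.ofReal x ≤ ∫⁻ s in A, ENNReal.ofReal (f s) →
      ENNReal.ofReal (e * x) ≤ ∫⁻ s in A, ENNReal.ofReal (g s) := by
    intro A f g x hA hfg hx
    rw [ENNReal.ofReal_mul he0.le]
    calc _ ≤ ENNReal.ofReal e * ∫⁻ s in A, ENNReal.ofReal (f s) := by gcongr
      _ = ∫⁻ s in A, ENNReal.ofReal e * ENNReal.ofReal (f s) :=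
        (lintegral_const_mul' _ _ ENNReal.ofReal_ne_top).symm
      _ ≤ _ := setLIntegral_mono' hA fun s hs => by
        rw [← ENNReal.ofReal_mul he0.le]; exact ENNReal.ofReal_le_ofReal (hfg s hs)
  rcases le_or_gt ‖ζ‖ (t * (‖w‖ / 2) / 2) with h2 | h2
  · have h3 := hmul _ _ (fun s => (√s ^ d)⁻¹ *
      Real.exp (-(‖ζ - s • ((1 / 2 : ℝ) • w)‖ ^ 2 / (2 * s)))) _ measurableSet_Ioo ?_
      (h t ‖ζ‖ (‖w‖ / 2) ht hr (by positivity) (by nlinarith) h2)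
    · have h4 : ENNReal.ofReal (e * krad d t ‖ζ‖ ‖w‖) ≤ ENNReal.ofReal (c / 2 ^ d)⁻¹ *
          driftKernel 2 t ζ ((1 / 2 : ℝ) • w) := by
        refine le_inv_mul_of_ofReal_mul_le (by positivity)
          ((ENNReal.ofReal_le_ofReal ?_).trans h3)
        have := krad_le_half hd (t := t) ht hr ha
        calc _ ≤ c / 2 ^ d * (e * (2 ^ d * krad d t ‖ζ‖ (‖w‖ / 2))) := by gcongr
          _ = _ := by field_simp
      exact h4.trans (mul_le_mul' le_self_add le_self_add)
    · intro s hs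
      have hs0 := hs.1
      rw [norm_sub_smul_sq_div ζ _ hs0.ne' (by norm_num), mul_left_comm, he, ← Real.exp_add, hb,
        inner_smul_right]
      apply le_of_eq
      congr 2
      ring
  -- The window `(r/(2a), r/a)` of `peak_le_laplace` lies in `(t/8, t)` because `t a/4 < r ≤ t a`.
  · have h3 := hmul (Set.Ioo (t / 8) t) _ (fun s => (√s ^ d)⁻¹ *
      Real.exp (-(‖ζ - s • w‖ ^ 2 / (4 * s)))) _ measurableSet_Ioo ?_
      (peak_le_laplace d hr ha (by nlinarith) (Set.Ioo_subset_Ioo ?_ ?_))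
    · have h4 : ENNReal.ofReal (e * krad d t ‖ζ‖ ‖w‖) ≤
          ENNReal.ofReal (Real.exp (-1) / 8 / 5 ^ d)⁻¹ * ∫⁻ s in Set.Ioo (t / 8) t,
          ENNReal.ofReal ((√s ^ d)⁻¹ * Real.exp (-(‖ζ - s • w‖ ^ 2 / (4 * s)))) := by
        refine le_inv_mul_of_ofReal_mul_le (by positivity)
          ((ENNReal.ofReal_le_ofReal ?_).trans h3)
        have := krad_le_peak hd ht hr ha (by nlinarith)
        calc _ ≤ Real.exp (-1) / 8 / 5 ^ d * (e * (5 ^ d * peak d ‖ζ‖ ‖w‖)) := by gcongr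
          _ = _ := by field_simp
      exact h4.trans (mul_le_mul' le_add_self le_add_self)
    · intro s hs
      have hs0 : 0 < s := lt_trans (by positivity) hs.1
      rw [norm_sub_smul_sq_div ζ w hs0.ne' (by norm_num), mul_left_comm, he, ← Real.exp_add]
      gcongr
      have : (‖ζ‖ - s * ‖w‖) ^ 2 / (4 * s) ≤ (‖ζ‖ - s * ‖w‖) ^ 2 / (2 * s) := by
        gcongr; norm_num
      linarith
    · rw [le_div_iff₀ (by positivity)]; nlinarith
    · rwa [div_le_iff₀ ha]

/-! ### Gaussian averages and masses of balls. -/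

/-- The largest `v`-mass of a closed ball of radius `ρ`. -/
noncomputable def ballSup {d : ℕ} (v : EuclideanSpace ℝ (Fin d) → ℝ≥0∞) (ρ : ℝ) : ℝ≥0∞ :=
  ⨆ x, ∫⁻ z in Metric.closedBall x ρ, v z

/-- Replace `k (z - x)` by the average of `h` over the ball of radius `ρ` about `z - x` and apply
Tonelli: for fixed `u`, the variable `z` runs over a ball centred at `x + u`. -/
lemma volume_closedBall_mul_lintegral_le {d : ℕ} {k h v : EuclideanSpace ℝ (Fin d) → ℝ≥0∞}
    {ρ : ℝ} (hh : Measurable h) (hv : Measurable v)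
    (hkh : ∀ ζ u, ‖u - ζ‖ ≤ ρ → k ζ ≤ h u) (x : EuclideanSpace ℝ (Fin d)) :
    volume (Metric.closedBall (0 : EuclideanSpace ℝ (Fin d)) ρ) * ∫⁻ z, k (z - x) * v z ≤
      (∫⁻ u, h u) * ballSup v ρ := by
  have hfin : volume (Metric.closedBall (0 : EuclideanSpace ℝ (Fin d)) ρ) ≠ ⊤ :=
    measure_closedBall_lt_top.ne
  have hS : MeasurableSet {p : EuclideanSpace ℝ (Fin d) × EuclideanSpace ℝ (Fin d) |
      ‖p.2 - (p.1 - x)‖ ≤ ρ} := measurableSet_le (by fun_prop) (by fun_prop)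
  have hswap : Measurable (Function.uncurry fun z u : EuclideanSpace ℝ (Fin d) =>
      {p : EuclideanSpace ℝ (Fin d) × EuclideanSpace ℝ (Fin d) |
        ‖p.2 - (p.1 - x)‖ ≤ ρ}.indicator (fun p => h p.2 * v p.1) (z, u)) := by
    exact Measurable.indicator (by fun_prop) hS
  calc _ = ∫⁻ z, volume (Metric.closedBall (0 : EuclideanSpace ℝ (Fin d)) ρ) *
          (k (z - x) * v z) := (lintegral_const_mul' _ _ hfin).symm
    _ ≤ ∫⁻ z, ∫⁻ u, {p : EuclideanSpace ℝ (Fin d) × EuclideanSpace ℝ (Fin d) |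
        ‖p.2 - (p.1 - x)‖ ≤ ρ}.indicator (fun p => h p.2 * v p.1) (z, u) := by
      refine lintegral_mono fun z => ?_
      rw [← Measure.addHaar_closedBall_center volume (z - x), mul_comm, ← setLIntegral_const,
        ← lintegral_indicator Metric.isClosed_closedBall.measurableSet]
      refine lintegral_mono fun u => ?_
      by_cases hu : ‖u - (z - x)‖ ≤ ρ
      · rw [Set.indicator_of_mem (by rwa [mem_closedBall_iff_norm]),
          Set.indicator_of_mem (by exact hu)]
        exact mul_le_mul_left (hkh _ _ hu) _
      · rw [Set.indicator_of_notMem (by rwa [mem_closedBall_iff_norm])]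
        exact zero_le
    _ = ∫⁻ u, ∫⁻ z, {p : EuclideanSpace ℝ (Fin d) × EuclideanSpace ℝ (Fin d) |
        ‖p.2 - (p.1 - x)‖ ≤ ρ}.indicator (fun p => h p.2 * v p.1) (z, u) :=
      lintegral_lintegral_swap hswap.aemeasurable
    _ ≤ ∫⁻ u, h u * ballSup v ρ := by
      refine lintegral_mono fun u => ?_
      have : ∀ z, {p : EuclideanSpace ℝ (Fin d) × EuclideanSpace ℝ (Fin d) |
          ‖p.2 - (p.1 - x)‖ ≤ ρ}.indicator (fun p => h p.2 * v p.1) (z, u) =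
          h u * (Metric.closedBall (x + u) ρ).indicator v z := by
        intro z
        have e : ‖u - (z - x)‖ = ‖z - (x + u)‖ := by
          rw [← norm_neg]; congr 1; abel
        by_cases hu : ‖u - (z - x)‖ ≤ ρ
        · rw [Set.indicator_of_mem (by exact hu),
            Set.indicator_of_mem (by rwa [mem_closedBall_iff_norm, ← e])]
        · rw [Set.indicator_of_notMem (by exact hu),
            Set.indicator_of_notMem (by rwa [mem_closedBall_iff_norm, ← e]), mul_zero]
      simp only [this]
      rw [lintegral_const_mul _ (hv.indicator Metric.isClosed_closedBall.measurableSet),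
        lintegral_indicator Metric.isClosed_closedBall.measurableSet]
      gcongr
      exact le_iSup (fun y => ∫⁻ z in Metric.closedBall y ρ, v z) (x + u)
    _ = _ := lintegral_mul_const _ hh

lemma lintegral_exp_neg_mul_norm_sq {d : ℕ} {b : ℝ} (hb : 0 < b) :
    ∫⁻ u : EuclideanSpace ℝ (Fin d), ENNReal.ofReal (Real.exp (-b * ‖u‖ ^ 2)) =
      ENNReal.ofReal (√(Real.pi / b) ^ d) := by
  have hI := GaussianFourier.integral_rexp_neg_mul_sq_norm (V := EuclideanSpace ℝ (Fin d)) hb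
  have hpos : 0 < Real.pi / b := by positivity
  rw [finrank_euclideanSpace_fin] at hI
  have hint : Integrable fun u : EuclideanSpace ℝ (Fin d) => Real.exp (-b * ‖u‖ ^ 2) :=
    Integrable.of_integral_ne_zero (by rw [hI]; positivity)
  rw [← ofReal_integral_eq_lintegral_ofReal hint
    (Filter.Eventually.of_forall fun _ => (Real.exp_pos _).le), hI, Real.sqrt_eq_rpow,
    ← Real.rpow_natCast, ← Real.rpow_mul hpos.le]
  congr 2; ring

lemma lintegral_gaussian_mul_le (d : ℕ) {c : ℝ} (hc : 0 < c) : ∃ C : ℝ≥0∞, C ≠ ⊤ ∧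
    ∀ (t : ℝ) (v : EuclideanSpace ℝ (Fin d) → ℝ≥0∞) (x : EuclideanSpace ℝ (Fin d)), 0 < t →
      Measurable v →
      ∫⁻ z, ENNReal.ofReal (Real.exp (-(‖z - x‖ ^ 2 / (c * t)))) * v z ≤ C * ballSup v √t := by
  have hω0 : volume (Metric.closedBall (0 : EuclideanSpace ℝ (Fin d)) 1) ≠ 0 :=
    (Metric.measure_closedBall_pos volume _ one_pos).ne'
  have hω1 : volume (Metric.closedBall (0 : EuclideanSpace ℝ (Fin d)) 1) ≠ ⊤ :=
    measure_closedBall_lt_top.ne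
  refine ⟨(volume (Metric.closedBall (0 : EuclideanSpace ℝ (Fin d)) 1))⁻¹ *
    ENNReal.ofReal (Real.exp (1 / c) * √(Real.pi * (2 * c)) ^ d), by finiteness,
    fun t v x ht hv => ?_⟩
  have hq := Real.sqrt_pos.2 ht
  have h := volume_closedBall_mul_lintegral_le
    (k := fun ζ : EuclideanSpace ℝ (Fin d) => ENNReal.ofReal (Real.exp (-(‖ζ‖ ^ 2 / (c * t)))))
    (h := fun u => ENNReal.ofReal (Real.exp (1 / c)) *
      ENNReal.ofReal (Real.exp (-(1 / (2 * c * t)) * ‖u‖ ^ 2))) (v := v) (ρ := √t)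
    (by fun_prop) hv ?_ x
  · rw [lintegral_const_mul _ (by fun_prop), lintegral_exp_neg_mul_norm_sq (by positivity),
      Measure.addHaar_closedBall' _ _ hq.le, finrank_euclideanSpace_fin] at h
    have e : √(Real.pi / (1 / (2 * c * t))) ^ d = √(Real.pi * (2 * c)) ^ d * √t ^ d := by
      rw [← mul_pow, ← Real.sqrt_mul (by positivity)]
      congr 2
      field_simp
    rw [e, ← ENNReal.ofReal_mul (by positivity), ← mul_assoc (Real.exp _),
      ENNReal.ofReal_mul (by positivity), mul_comm (ENNReal.ofReal (_ * √(Real.pi * (2 * c)) ^ d)),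
      mul_assoc, mul_assoc, ENNReal.mul_le_mul_iff_right (ENNReal.ofReal_pos.2 (by positivity)).ne'
        ENNReal.ofReal_ne_top] at h
    rw [mul_assoc, ← ENNReal.inv_mul_cancel_left hω0 hω1 (b := ∫⁻ z, _)]
    exact mul_le_mul_right h _
  · intro ζ u hu
    rw [← ENNReal.ofReal_mul (by positivity), ← Real.exp_add]
    gcongr
    have h1 : ‖u‖ ≤ ‖ζ‖ + √t := by
      have := norm_sub_norm_le u ζ; linarith
    -- Moving by `√t` costs the factor `exp (1/c)` and half of the Gaussian exponent.
    have h2 : ‖u‖ ^ 2 ≤ 2 * ‖ζ‖ ^ 2 + 2 * t := by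
      have : ‖u‖ ^ 2 ≤ (‖ζ‖ + √t) ^ 2 := by gcongr
      nlinarith [sq_nonneg (‖ζ‖ - √t), Real.sq_sqrt ht.le]
    have h3 : 1 / (2 * c * t) * ‖u‖ ^ 2 ≤ 1 / (2 * c * t) * (2 * ‖ζ‖ ^ 2 + 2 * t) := by gcongr
    have h4 : 1 / (2 * c * t) * (2 * ‖ζ‖ ^ 2 + 2 * t) = ‖ζ‖ ^ 2 / (c * t) + 1 / c := by field_simp
    linarith

/-! ### The Brownian bridge and `S`. -/

lemma lintegral_kernel_swap {d : ℕ} {k : ℝ → EuclideanSpace ℝ (Fin d) → ℝ≥0∞}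
    {v : EuclideanSpace ℝ (Fin d) → ℝ≥0∞} (hk : Measurable (Function.uncurry k))
    (hv : Measurable v) (A : Set ℝ) :
    ∫⁻ s in A, ∫⁻ z, k s z * v z = ∫⁻ z, (∫⁻ s in A, k s z) * v z := by
  rw [lintegral_lintegral_swap]
  · refine lintegral_congr fun z => ?_
    exact lintegral_mul_const _ (hk.comp (measurable_id.prodMk measurable_const))
  · exact (hk.mul (hv.comp measurable_snd)).aemeasurable

lemma g_eq {d : ℕ} {t : ℝ} (ht : 0 < t) (x y : EuclideanSpace ℝ (Fin d)) :
    g t x y = (√(4 * Real.pi * t) ^ d)⁻¹ * Real.exp (-(‖y - x‖ ^ 2 / (4 * t))) := by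
  have h : 0 < 4 * Real.pi * t := by positivity
  rw [g, Real.sqrt_eq_rpow, ← Real.rpow_natCast _ d, ← Real.rpow_mul h.le, ← Real.rpow_neg h.le,
    neg_div, neg_div]
  congr 2; ring

lemma g_symm {d : ℕ} (t : ℝ) (x y : EuclideanSpace ℝ (Fin d)) : g t x y = g t y x := by
  rw [g, g, norm_sub_rev]

lemma bridge_eq {d : ℕ} {s t : ℝ} (hs : 0 < s) (hst : s < t) (x y z : EuclideanSpace ℝ (Fin d)) :
    g s x z * g (t - s) z y / g t x y = (√(4 * Real.pi * (s * (t - s) / t)) ^ d)⁻¹ *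
      Real.exp (-(‖z - x - s • (t⁻¹ • (y - x))‖ ^ 2 / (4 * (s * (t - s) / t)))) := by
  have ht : 0 < t := hs.trans hst
  have hts : 0 < t - s := sub_pos.2 hst
  rw [g_eq hs, g_eq hts, g_eq ht]
  have h1 : √(4 * Real.pi * (s * (t - s) / t)) =
      √(4 * Real.pi * s) * √(4 * Real.pi * (t - s)) / √(4 * Real.pi * t) := by
    rw [← Real.sqrt_mul (by positivity), ← Real.sqrt_div (by positivity)]
    congr 1; field_simp
  have hp1 : 0 < √(4 * Real.pi * s) := Real.sqrt_pos.2 (by positivity)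
  have hp2 : 0 < √(4 * Real.pi * (t - s)) := Real.sqrt_pos.2 (by positivity)
  have hp3 : 0 < √(4 * Real.pi * t) := Real.sqrt_pos.2 (by positivity)
  have h2 : -(‖z - x - s • (t⁻¹ • (y - x))‖ ^ 2 / (4 * (s * (t - s) / t))) =
      -(‖z - x‖ ^ 2 / (4 * s)) + -(‖y - z‖ ^ 2 / (4 * (t - s))) - -(‖y - x‖ ^ 2 / (4 * t)) := by
    have e : y - z = (y - x) - (z - x) := by abel
    rw [e, norm_sub_sq_real (y - x), norm_sub_sq_real (z - x), smul_smul, inner_smul_right,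
      norm_smul, mul_pow, Real.norm_eq_abs, sq_abs, real_inner_comm (y - x) (z - x)]
    have := hts.ne'
    field_simp
    ring
  rw [h1, h2, Real.exp_sub, Real.exp_add, div_pow, mul_pow]
  field_simp

lemma le_bridge {d : ℕ} {s t : ℝ} (hs : s ∈ Set.Ioo 0 (t / 2)) (x y z : EuclideanSpace ℝ (Fin d)) :
    (√(4 * Real.pi) ^ d)⁻¹ * ((√s ^ d)⁻¹ *
      Real.exp (-(‖z - x - s • (t⁻¹ • (y - x))‖ ^ 2 / (2 * s)))) ≤
      g s x z * g (t - s) z y / g t x y := by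
  obtain ⟨hs0, hs1⟩ := hs
  have ht : 0 < t := by linarith
  have hts : 0 < t - s := by linarith
  rw [bridge_eq hs0 (by linarith), ← mul_assoc, ← mul_inv, ← mul_pow,
    ← Real.sqrt_mul (by positivity)]
  have h0 : 0 < √(4 * Real.pi * (s * (t - s) / t)) := Real.sqrt_pos.2 (by positivity)
  have h1 : s * (t - s) / t ≤ s := by
    rw [div_le_iff₀ ht]; nlinarith
  have h2 : 2 * s ≤ 4 * (s * (t - s) / t) := by
    rw [← mul_div_assoc, le_div_iff₀ ht]; nlinarith
  gcongr

lemma bridge_le {d : ℕ} {s t : ℝ} (hs : s ∈ Set.Ioo 0 (t / 2)) (x y z : EuclideanSpace ℝ (Fin d)) :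
    g s x z * g (t - s) z y / g t x y ≤ (√s ^ d)⁻¹ *
      Real.exp (-(‖z - x - s • (t⁻¹ • (y - x))‖ ^ 2 / (4 * s))) := by
  obtain ⟨hs0, hs1⟩ := hs
  have ht : 0 < t := by linarith
  have hts : 0 < t - s := by linarith
  rw [bridge_eq hs0 (by linarith)]
  have h0 : 0 < √s := Real.sqrt_pos.2 hs0
  have h1 : s * (t - s) / t ≤ s := by
    rw [div_le_iff₀ ht]; nlinarith
  have h2 : s ≤ 4 * Real.pi * (s * (t - s) / t) := by
    have : s / 2 ≤ s * (t - s) / t := by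
      rw [div_le_div_iff₀ (by norm_num) ht]; nlinarith
    nlinarith [Real.pi_gt_three]
  gcongr

lemma measurable_drift {d : ℕ} (c : ℝ) (x w : EuclideanSpace ℝ (Fin d)) :
    Measurable (Function.uncurry fun (s : ℝ) (z : EuclideanSpace ℝ (Fin d)) =>
      ENNReal.ofReal ((√s ^ d)⁻¹ * Real.exp (-(‖z - x - s • w‖ ^ 2 / (c * s))))) := by
  unfold Function.uncurry
  fun_prop

lemma lintegral_driftKernel_le_S (d : ℕ) : ∃ C : ℝ≥0∞, C ≠ ⊤ ∧
    ∀ (V : EuclideanSpace ℝ (Fin d) → ℝ) (t : ℝ) (x w : EuclideanSpace ℝ (Fin d)), Measurable V →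
      0 < t → ∫⁻ z, driftKernel 2 t (z - x) w * ENNReal.ofReal |V z| ≤ C * S V t x (x + t • w) := by
  refine ⟨ENNReal.ofReal (√(4 * Real.pi) ^ d), ENNReal.ofReal_ne_top, fun V t x w hV ht => ?_⟩
  have hp : 0 < √(4 * Real.pi) := Real.sqrt_pos.2 (by positivity)
  unfold driftKernel
  rw [← lintegral_kernel_swap (measurable_drift 2 x w) (by fun_prop), S,
    ← lintegral_const_mul' _ _ ENNReal.ofReal_ne_top]
  refine (setLIntegral_mono' measurableSet_Ioo fun s hs => ?_).trans
    (lintegral_mono_set (Set.Ioo_subset_Ioo_right (by linarith)))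
  rw [← lintegral_const_mul' _ _ ENNReal.ofReal_ne_top]
  refine lintegral_mono fun z => ?_
  have h := le_bridge hs x (x + t • w) z
  rw [add_sub_cancel_left, inv_smul_smul₀ ht.ne'] at h
  rw [← ENNReal.ofReal_mul' (abs_nonneg _), ← ENNReal.ofReal_mul (by positivity), ← mul_assoc]
  rw [inv_mul_le_iff₀ (by positivity)] at h
  exact ENNReal.ofReal_le_ofReal (mul_le_mul_of_nonneg_right h (abs_nonneg _))

/-- Times after `t/2` are reflected by `s ↦ t - s`; the symmetry of `g` turns them into the first
half of the bridge from `y` to `x`. -/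
lemma S_le_lintegral_driftKernel {d : ℕ} {V : EuclideanSpace ℝ (Fin d) → ℝ} (hV : Measurable V)
    (t : ℝ) (x y : EuclideanSpace ℝ (Fin d)) :
    S V t x y ≤ (∫⁻ z, driftKernel 4 t (z - x) (t⁻¹ • (y - x)) * ENNReal.ofReal |V z|) +
      ∫⁻ z, driftKernel 4 t (z - y) (t⁻¹ • (x - y)) * ENNReal.ofReal |V z| := by
  have half : ∀ x y : EuclideanSpace ℝ (Fin d), ∫⁻ s in Set.Ioo 0 (t / 2), ∫⁻ z,
      ENNReal.ofReal (g s x z * g (t - s) z y / g t x y * |V z|) ≤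
      ∫⁻ z, driftKernel 4 t (z - x) (t⁻¹ • (y - x)) * ENNReal.ofReal |V z| := by
    intro x y
    unfold driftKernel
    rw [← lintegral_kernel_swap (measurable_drift 4 x _) (by fun_prop)]
    refine setLIntegral_mono' measurableSet_Ioo fun s hs => lintegral_mono fun z => ?_
    rw [← ENNReal.ofReal_mul' (abs_nonneg _)]
    exact ENNReal.ofReal_le_ofReal
      (mul_le_mul_of_nonneg_right (bridge_le hs x y z) (abs_nonneg _))
  have hsub : Set.Ioo 0 t ⊆ Set.Ioo 0 (t / 2) ∪ Set.Ico (t / 2) t := fun s hs => by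
    rcases lt_or_ge s (t / 2) with h | h
    · exact Or.inl ⟨hs.1, h⟩
    · exact Or.inr ⟨h, hs.2⟩
  refine (lintegral_mono_set hsub).trans ((lintegral_union_le _ _ _).trans
    (add_le_add (half x y) (le_trans (le_of_eq ?_) (half y x))))
  rw [← setLIntegral_congr Ioo_ae_eq_Ico, ← lintegral_indicator measurableSet_Ioo,
    ← lintegral_indicator measurableSet_Ioo, ← lintegral_sub_left_eq_self _ t]
  refine lintegral_congr fun s => ?_
  by_cases hs : s ∈ Set.Ioo 0 (t / 2)
  · have hs' : t - s ∈ Set.Ioo (t / 2) t := ⟨by linarith [hs.2], by linarith [hs.1]⟩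
    rw [Set.indicator_of_mem hs, Set.indicator_of_mem hs']
    refine lintegral_congr fun z => ?_
    rw [sub_sub_cancel, g_symm (t - s) x z, g_symm s z y, g_symm t x y, mul_comm (g (t - s) z x)]
  · rw [Set.indicator_of_notMem hs, Set.indicator_of_notMem]
    exact fun h => hs ⟨by linarith [h.2], by linarith [h.1]⟩

/-! ### Comparison of the two norms. -/

lemma ae_sub_ne_zero {d : ℕ} (hd : 1 ≤ d) (x : EuclideanSpace ℝ (Fin d)) :
    ∀ᵐ z : EuclideanSpace ℝ (Fin d), z - x ≠ 0 := by
  have : Nonempty (Fin d) := ⟨⟨0, hd⟩⟩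
  have h : volume ({x} : Set (EuclideanSpace ℝ (Fin d))) = 0 := measure_singleton x
  filter_upwards [compl_mem_ae_iff.2 h] with z hz
  exact sub_ne_zero.2 hz

lemma exists_norm_eq {d : ℕ} (hd : 1 ≤ d) {a : ℝ} (ha : 0 ≤ a) :
    ∃ w : EuclideanSpace ℝ (Fin d), ‖w‖ = a := by
  have : Nonempty (Fin d) := ⟨⟨0, hd⟩⟩
  exact _root_.exists_norm_eq _ ha

lemma KV_eq {d : ℕ} (V : EuclideanSpace ℝ (Fin d) → ℝ) (t : ℝ) (x w : EuclideanSpace ℝ (Fin d)) :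
    KV V t x w = ∫⁻ z, ENNReal.ofReal (K t (z - x) w) * ENNReal.ofReal |V z| := by
  simp only [KV, ENNReal.ofReal_mul' (abs_nonneg _)]

lemma KV_le_normK {d : ℕ} (V : EuclideanSpace ℝ (Fin d) → ℝ) (t : ℝ)
    (x w : EuclideanSpace ℝ (Fin d)) : KV V t x w ≤ normK V t :=
  le_iSup₂ (f := fun x w => KV V t x w) x w

lemma S_le_normSUpTo {d : ℕ} (V : EuclideanSpace ℝ (Fin d) → ℝ) {T : ℝ} (hT : 0 < T)
    (x y : EuclideanSpace ℝ (Fin d)) : S V T x y ≤ normSUpTo V T :=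
  (le_iSup₂ (f := fun x y => S V T x y) x y).trans
    (le_iSup₂ (f := fun t (_ : t ∈ Set.Ioc 0 T) => normS V t) T ⟨hT, le_rfl⟩)

lemma normK_mono {d : ℕ} (hd : 1 ≤ d) (V : EuclideanSpace ℝ (Fin d) → ℝ) {t T : ℝ} (ht : 0 ≤ t)
    (htT : t ≤ T) : normK V t ≤ normK V T := by
  refine iSup₂_mono fun x w => lintegral_mono fun z => ENNReal.ofReal_le_ofReal ?_
  exact mul_le_mul_of_nonneg_right (K_mono hd ht htT _ _) (abs_nonneg _)

lemma mul_ballSup_le {d : ℕ} (hd : 1 ≤ d) {v : EuclideanSpace ℝ (Fin d) → ℝ≥0∞}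
    {k : EuclideanSpace ℝ (Fin d) → ℝ≥0∞} {ρ : ℝ} {c N : ℝ≥0∞} (hc : c ≠ ⊤)
    (hk : ∀ ζ, ζ ≠ 0 → ‖ζ‖ ≤ ρ → c ≤ k ζ)
    (hN : ∀ x, ∫⁻ z, k (z - x) * v z ≤ N) : c * ballSup v ρ ≤ N := by
  rw [ballSup, ENNReal.mul_iSup]
  refine iSup_le fun x => le_trans ?_ (hN x)
  rw [← lintegral_const_mul' _ _ hc]
  refine le_trans ?_ (setLIntegral_le_lintegral (Metric.closedBall x ρ) _)
  refine lintegral_mono_ae ?_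
  filter_upwards [ae_restrict_of_ae (ae_sub_ne_zero hd x),
    ae_restrict_mem Metric.isClosed_closedBall.measurableSet] with z hz hz'
  exact mul_le_mul_left (hk _ hz (mem_closedBall_iff_norm.1 hz')) _

lemma ballSup_le_normK {d : ℕ} (hd : 1 ≤ d) : ∃ C : ℝ≥0∞, C ≠ ⊤ ∧
    ∀ (V : EuclideanSpace ℝ (Fin d) → ℝ) (t : ℝ), 0 < t →
      ENNReal.ofReal (t / √t ^ d) * ballSup (fun z => ENNReal.ofReal |V z|) √t ≤
        C * normK V t := by
  refine ⟨ENNReal.ofReal (2 * Real.exp 1), ENNReal.ofReal_ne_top, fun V t ht => ?_⟩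
  obtain ⟨w, hw⟩ := exists_norm_eq hd (show 0 ≤ 1 / √t by positivity)
  refine mul_ballSup_le hd (k := fun ζ => ENNReal.ofReal (2 * Real.exp 1) *
    ENNReal.ofReal (K t ζ w)) ENNReal.ofReal_ne_top ?_ ?_
  · intro ζ hζ hζt
    rw [← ENNReal.ofReal_mul (by positivity)]
    apply ENNReal.ofReal_le_ofReal
    have h1 := le_krad_inv_sqrt hd ht (norm_pos_iff.2 hζ) hζt
    have h2 := krad_le_K_of_norm_eq hd ht hw hζt
    linarith
  · intro x
    simp only [mul_assoc]
    rw [lintegral_const_mul' _ _ ENNReal.ofReal_ne_top, ← KV_eq]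
    gcongr
    exact KV_le_normK _ _ _ _

/-- The bridge from a point to itself, at times in `(t/4, t/2)`, has density at least a multiple of
`√t ^ (-d)` on the ball of radius `√t`. -/
lemma ballSup_le_normSUpTo {d : ℕ} (hd : 1 ≤ d) : ∃ C : ℝ≥0∞, C ≠ ⊤ ∧
    ∀ (V : EuclideanSpace ℝ (Fin d) → ℝ) (t : ℝ), Measurable V → 0 < t →
      ENNReal.ofReal (t / √t ^ d) * ballSup (fun z => ENNReal.ofReal |V z|) √t ≤
        C * normSUpTo V t := by
  obtain ⟨C, hC, h⟩ := lintegral_driftKernel_le_S d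
  refine ⟨ENNReal.ofReal (Real.exp (-2) / 4)⁻¹ * C, by finiteness, fun V t hV ht => ?_⟩
  have hq := Real.sqrt_pos.2 ht
  refine mul_ballSup_le hd (k := fun ζ => ENNReal.ofReal (Real.exp (-2) / 4)⁻¹ *
    driftKernel 2 t ζ 0) ENNReal.ofReal_ne_top ?_ ?_
  · intro ζ _ hζt
    refine le_inv_mul_of_ofReal_mul_le (by positivity) ?_
    refine ofReal_const_mul_le_of_le (ofReal_mul_sub_le_setLIntegral (x := t / 4) (y := t / 2)
      (c := (√t ^ d)⁻¹ * Real.exp (-2)) (by positivity)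
      (Set.Ioo_subset_Ioo_left (by positivity)) ?_) (le_of_eq (by ring))
    intro s hs
    have hs0 : 0 < s := lt_trans (by positivity) hs.1
    have := Real.sqrt_pos.2 hs0
    have h1 : s ≤ t := by linarith [hs.2]
    have h2 : ‖ζ - s • (0 : EuclideanSpace ℝ (Fin d))‖ ^ 2 / (2 * s) ≤ 2 := by
      rw [smul_zero, sub_zero, div_le_iff₀ (by positivity)]
      have : ‖ζ‖ ^ 2 ≤ √t ^ 2 := by gcongr
      rw [Real.sq_sqrt ht.le] at this
      linarith [hs.1]
    gcongr
  · intro x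
    simp only [mul_assoc]
    rw [lintegral_const_mul' _ _ ENNReal.ofReal_ne_top]
    gcongr
    refine (h V t x 0 hV ht).trans ?_
    gcongr
    exact S_le_normSUpTo _ ht _ _

lemma normSUpTo_le_normK {d : ℕ} (hd : 1 ≤ d) : ∃ C : ℝ≥0∞, C ≠ ⊤ ∧
    ∀ (V : EuclideanSpace ℝ (Fin d) → ℝ) (T : ℝ), Measurable V →
      normSUpTo V T ≤ C * normK V T := by
  obtain ⟨C₁, hC₁, h₁⟩ := driftKernel_le hd
  obtain ⟨C₂, hC₂, h₂⟩ := lintegral_gaussian_mul_le d (show (0 : ℝ) < 64 by norm_num)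
  obtain ⟨C₃, hC₃, h₃⟩ := ballSup_le_normK hd
  refine ⟨2 * (C₁ * (2 + C₂ * C₃)), by finiteness, fun V T hV => ?_⟩
  refine iSup₂_le fun t ht => iSup₂_le fun x y => ?_
  obtain ⟨ht0, htT⟩ := ht
  obtain ⟨w₀, hw₀⟩ := exists_norm_eq hd (show 0 ≤ 1 / √t by positivity)
  have hv : Measurable fun z => ENNReal.ofReal |V z| := by fun_prop
  have hK : ∀ x w : EuclideanSpace ℝ (Fin d),
      Measurable fun z => ENNReal.ofReal (K t (z - x) w) * ENNReal.ofReal |V z| := by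
    intro x w
    refine Measurable.mul ?_ hv
    simp only [K_eq hd ht0.le]
    refine Measurable.ennreal_ofReal (Measurable.ite (measurableSet_le (by fun_prop) (by fun_prop))
      (Measurable.mul (by fun_prop) ?_) measurable_const)
    unfold krad
    split_ifs <;> fun_prop
  have key : ∀ x w : EuclideanSpace ℝ (Fin d),
      ∫⁻ z, driftKernel 4 t (z - x) w * ENNReal.ofReal |V z| ≤
        C₁ * (2 + C₂ * C₃) * normK V T := by
    intro x w
    calc _ ≤ ∫⁻ z, C₁ * (ENNReal.ofReal (K t (z - x) w) * ENNReal.ofReal |V z| +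
          ENNReal.ofReal (K t (z - x) w₀) * ENNReal.ofReal |V z| + ENNReal.ofReal (t / √t ^ d) *
          (ENNReal.ofReal (Real.exp (-(‖z - x‖ ^ 2 / (64 * t)))) * ENNReal.ofReal |V z|)) := by
          refine lintegral_mono_ae ?_
          filter_upwards [ae_sub_ne_zero hd x] with z hz
          refine (mul_le_mul_left (h₁ t (z - x) w w₀ ht0 hz hw₀) _).trans_eq ?_
          ring
      _ = C₁ * (KV V t x w + KV V t x w₀ + ENNReal.ofReal (t / √t ^ d) *
          ∫⁻ z, ENNReal.ofReal (Real.exp (-(‖z - x‖ ^ 2 / (64 * t)))) * ENNReal.ofReal |V z|) := by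
          rw [lintegral_const_mul' _ _ hC₁, lintegral_add_left (by exact (hK x w).add (hK x w₀)),
            lintegral_add_left (hK x w), lintegral_const_mul' _ _ ENNReal.ofReal_ne_top,
            KV_eq, KV_eq]
      _ ≤ C₁ * (normK V t + normK V t + ENNReal.ofReal (t / √t ^ d) *
          (C₂ * ballSup (fun z => ENNReal.ofReal |V z|) √t)) := by
          gcongr
          · exact KV_le_normK _ _ _ _
          · exact KV_le_normK _ _ _ _
          · exact h₂ t _ x ht0 hv
      _ = C₁ * (normK V t + normK V t + C₂ * (ENNReal.ofReal (t / √t ^ d) *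
          ballSup (fun z => ENNReal.ofReal |V z|) √t)) := by ring
      _ ≤ C₁ * (normK V t + normK V t + C₂ * (C₃ * normK V t)) := by
          gcongr C₁ * (_ + _ + C₂ * ?_)
          exact h₃ V t ht0
      _ = C₁ * (2 + C₂ * C₃) * normK V t := by ring
      _ ≤ _ := by
          gcongr
          exact normK_mono hd V ht0.le htT
  refine (S_le_lintegral_driftKernel hV t x y).trans ((add_le_add (key _ _) (key _ _)).trans_eq ?_)
  ring

/-- At each time in `(t/8, t)` the kernel is at most a multiple of `√t ^ (-d)` times a Gaussian of
width `√t`. Its centre `x + s • w` moves, but `ballSup` is translation invariant, so integrating in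
time costs only a factor `t`. -/
lemma lintegral_late_le (d : ℕ) : ∃ C : ℝ≥0∞, C ≠ ⊤ ∧
    ∀ (v : EuclideanSpace ℝ (Fin d) → ℝ≥0∞) (t : ℝ) (x w : EuclideanSpace ℝ (Fin d)),
      Measurable v → 0 < t →
      ∫⁻ z, (∫⁻ s in Set.Ioo (t / 8) t, ENNReal.ofReal ((√s ^ d)⁻¹ *
        Real.exp (-(‖z - x - s • w‖ ^ 2 / (4 * s))))) * v z ≤
        C * (ENNReal.ofReal (t / √t ^ d) * ballSup v √t) := by
  obtain ⟨C, hC, h⟩ := lintegral_gaussian_mul_le d (show (0 : ℝ) < 4 by norm_num)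
  refine ⟨ENNReal.ofReal (8 ^ d) * C, by finiteness, fun v t x w hv ht => ?_⟩
  have hq := Real.sqrt_pos.2 ht
  rw [← lintegral_kernel_swap (measurable_drift 4 x w) hv]
  calc _ ≤ ∫⁻ s in Set.Ioo (t / 8) t,
        ENNReal.ofReal (8 ^ d * (√t ^ d)⁻¹) * (C * ballSup v √t) := by
        refine setLIntegral_mono' measurableSet_Ioo fun s hs => ?_
        have hs0 : 0 < s := lt_trans (by positivity) hs.1
        have hst := hs.2.le
        calc _ ≤ ∫⁻ z, ENNReal.ofReal (8 ^ d * (√t ^ d)⁻¹) *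
              (ENNReal.ofReal (Real.exp (-(‖z - (x + s • w)‖ ^ 2 / (4 * t)))) * v z) := by
              refine lintegral_mono fun z => ?_
              rw [← mul_assoc, ← ENNReal.ofReal_mul (by positivity), sub_add_eq_sub_sub]
              gcongr
              have h8 : √t / 8 ≤ √s := Real.le_sqrt_of_sq_le (by
                rw [div_pow, Real.sq_sqrt ht.le]; linarith [hs.1])
              calc (√s ^ d)⁻¹ ≤ ((√t / 8) ^ d)⁻¹ := by gcongr
                _ = _ := by rw [div_pow]; field_simp
          _ = ENNReal.ofReal (8 ^ d * (√t ^ d)⁻¹) * ∫⁻ z,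
              ENNReal.ofReal (Real.exp (-(‖z - (x + s • w)‖ ^ 2 / (4 * t)))) * v z :=
              lintegral_const_mul' _ _ ENNReal.ofReal_ne_top
          _ ≤ _ := by gcongr; exact h t v _ ht hv
    _ = ENNReal.ofReal (8 ^ d * (√t ^ d)⁻¹) * (C * ballSup v √t) *
        ENNReal.ofReal (t - t / 8) := by rw [setLIntegral_const, Real.volume_Ioo]
    _ ≤ ENNReal.ofReal (8 ^ d * (√t ^ d)⁻¹) * (C * ballSup v √t) * ENNReal.ofReal t := by
        gcongr; linarith
    _ = _ := by
        rw [div_eq_mul_inv t, ENNReal.ofReal_mul ht.le, ENNReal.ofReal_mul (by positivity)]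
        ring

/-- The time `t = T` alone suffices on the right. Small drifts, `T‖w‖² ≤ 1`, are compared with the
driftless bridge, the others with the halved drift and the late times. -/
lemma normK_le_normSUpTo {d : ℕ} (hd : 1 ≤ d) : ∃ C : ℝ≥0∞, C ≠ ⊤ ∧
    ∀ (V : EuclideanSpace ℝ (Fin d) → ℝ) (T : ℝ), Measurable V → 0 < T →
      normK V T ≤ C * normSUpTo V T := by
  obtain ⟨C₁, hC₁, h₁⟩ := K_le_driftKernel_zero hd
  obtain ⟨C₂, hC₂, h₂⟩ := K_le_driftKernel hd
  obtain ⟨C₃, hC₃, h₃⟩ := lintegral_driftKernel_le_S d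
  obtain ⟨C₄, hC₄, h₄⟩ := lintegral_late_le d
  obtain ⟨C₅, hC₅, h₅⟩ := ballSup_le_normSUpTo hd
  refine ⟨C₁ * C₃ + C₂ * (C₃ + C₄ * C₅), by finiteness, fun V T hV hT => ?_⟩
  have hv : Measurable fun z => ENNReal.ofReal |V z| := by fun_prop
  have hdrift : ∀ x w : EuclideanSpace ℝ (Fin d),
      ∫⁻ z, driftKernel 2 T (z - x) w * ENNReal.ofReal |V z| ≤ C₃ * normSUpTo V T := by
    intro x w
    refine (h₃ V T x w hV hT).trans ?_
    gcongr
    exact S_le_normSUpTo _ hT _ _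
  refine iSup₂_le fun x w => ?_
  rw [KV_eq]
  rcases le_total (T * ‖w‖ ^ 2) 1 with hw | hw
  · calc _ ≤ ∫⁻ z, C₁ * (driftKernel 2 T (z - x) 0 * ENNReal.ofReal |V z|) := by
          refine lintegral_mono_ae ?_
          filter_upwards [ae_sub_ne_zero hd x] with z hz
          rw [← mul_assoc]
          exact mul_le_mul_left (h₁ T (z - x) w hT hz hw) _
      _ = C₁ * ∫⁻ z, driftKernel 2 T (z - x) 0 * ENNReal.ofReal |V z| :=
          lintegral_const_mul' _ _ hC₁
      _ ≤ C₁ * (C₃ * normSUpTo V T) := by gcongr; exact hdrift x 0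
      _ ≤ _ := by rw [← mul_assoc]; gcongr; exact le_self_add
  · have hm : Measurable fun z => driftKernel 2 T (z - x) ((1 / 2 : ℝ) • w) *
        ENNReal.ofReal |V z| := by
      refine Measurable.mul ?_ hv
      exact Measurable.lintegral_prod_left (measurable_drift 2 x ((1 / 2 : ℝ) • w))
    calc _ ≤ ∫⁻ z, C₂ * (driftKernel 2 T (z - x) ((1 / 2 : ℝ) • w) * ENNReal.ofReal |V z| +
          (∫⁻ s in Set.Ioo (T / 8) T, ENNReal.ofReal ((√s ^ d)⁻¹ *
          Real.exp (-(‖z - x - s • w‖ ^ 2 / (4 * s))))) * ENNReal.ofReal |V z|) := by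
          refine lintegral_mono_ae ?_
          filter_upwards [ae_sub_ne_zero hd x] with z hz
          rw [← add_mul, ← mul_assoc]
          exact mul_le_mul_left (h₂ T (z - x) w hT hz hw) _
      _ ≤ C₂ * (C₃ * normSUpTo V T + C₄ * (C₅ * normSUpTo V T)) := by
          rw [lintegral_const_mul' _ _ hC₂, lintegral_add_left hm]
          gcongr
          · exact hdrift x _
          · refine (h₄ _ T x w hv hT).trans ?_
            gcongr C₄ * ?_
            exact h₅ V T hV hT
      _ = C₂ * (C₃ + C₄ * C₅) * normSUpTo V T := by ring
      _ ≤ _ := by gcongr; exact le_add_self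

end SharpGauss

theorem mainTheorem5 (d : ℕ) (hd : 1 ≤ d) :
    ∃ C₁ C₂ : ℝ, 0 < C₁ ∧ C₁ < C₂ ∧
      ∀ (T : ℝ), 0 < T → ∀ (V : EuclideanSpace ℝ (Fin d) → ℝ), Measurable V →
        ENNReal.ofReal C₁ * SharpGauss.normK V T ≤ SharpGauss.normSUpTo V T ∧
          SharpGauss.normSUpTo V T ≤ ENNReal.ofReal C₂ * SharpGauss.normK V T := by
  obtain ⟨A, hA, hlow⟩ := SharpGauss.normK_le_normSUpTo hd
  obtain ⟨B, hB, hup⟩ := SharpGauss.normSUpTo_le_normK hd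
  have hpos : 0 < A.toReal + 1 := by positivity
  -- The `+ 1` in the first constant guards against `A = 0`; the second constant contains the first
  -- only to make `C₁ < C₂` hold.
  refine ⟨(A.toReal + 1)⁻¹, (A.toReal + 1)⁻¹ + B.toReal + 1, by positivity, ?_, ?_⟩
  · linarith [ENNReal.toReal_nonneg (a := B)]
  · refine fun T hT V hV => ⟨?_, (hup V T hV).trans ?_⟩
    · have h1 : A ≤ ENNReal.ofReal (A.toReal + 1) := by
        rw [← ENNReal.ofReal_toReal hA]
        apply ENNReal.ofReal_le_ofReal
        rw [ENNReal.ofReal_toReal hA]; linarith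
      calc _ ≤ ENNReal.ofReal (A.toReal + 1)⁻¹ *
            (ENNReal.ofReal (A.toReal + 1) * SharpGauss.normSUpTo V T) := by
            gcongr
            exact (hlow V T hV hT).trans (by gcongr)
        _ = _ := by
            rw [← mul_assoc, ← ENNReal.ofReal_mul (by positivity), inv_mul_cancel₀ hpos.ne',
              ENNReal.ofReal_one, one_mul]
    · gcongr
      rw [← ENNReal.ofReal_toReal hB]
      apply ENNReal.ofReal_le_ofReal
      rw [ENNReal.ofReal_toReal hB]
      linarith [inv_pos.2 hpos]
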